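/- Let $c_1,\dots,c_{2n}$ be the $n$-qubit Majorana operators $c_{2j-1}=Z^{\otimes (j-1)}\otimes X\otimes I^{\otimes(n-j)}$, $c_{2j}=Z^{\otimes (j-1)}\otimes Y\otimes I^{\otimes(n-j)}$, let $\mathcal B_\kappa$ be the complex span of the products of $\kappa$ distinct Majorana operators, and let $G=e^{\mathfrak g}$, where $\mathfrak g$ is the real Lie algebra generated by $\{iZ_j\}_{1\le j\le n}\cup\{iX_jX_{j+1}\}_{1\le j<n}$. Let $U(\theta)\in G$ be a random circuit that forms a $2$-design over $G$ (its averages of $U^{\otimes t}A(U^{\otimes t})^\dagger$, $t\le 2$, agree with those over the normalized Haar measure of $G$), and let $\ell_\theta(\rho,O)=\mathrm{Tr}[U(\theta)\rho U(\theta)^\dagger O]$. A pure fermionic Gaussian state is $\rho=|\psi\rangle\langle\psi|$ with $|\psi\rangle=V|0\rangle^{\otimes n}$ or $|\psi\rangle=Vc_1|0\rangle^{\otimes n}$, $V\in G$. 1. Let $\kappa$ be even with $0<\kappa<2n$, $\rho$ a pure fermionic Gaussian state, and $O$ a Pauli observable (a Pauli string up to sign) in $\mathcal B_\kappa$, or more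 generally $O=V^\dagger SV$ with $S$ such an observable and $V\in G$. Then $$\mathrm{Var}_\theta[\ell_\theta(\rho,O)]=\binom{n}{\kappa/2}\binom{2n}{\kappa}^{-1}.$$ 2. For fixed $n$, this variance is strictly decreasing in the generalized globality $g(n,\kappa)=\min(\kappa,2n-\kappa)$. 3. For each $n$ let $U_n,\kappa_n,\rho_n,O_n$ be as above (the assumptions on $\kappa_n,\rho_n,O_n$ for all large $n$), let $v_n$ be the variance and $g_n=g(n,\kappa_n)$. Then, as $n\to\infty$: (a) there is a barren plateau in the exponential sense, $v_n\in\mathcal O(1/b^n)$ for some $b>1$, if and only if $g_n\in\Omega(n)$, i.e. $g_n\ge cn$ for some $c>0$ and all large $n$; (b) $v_n$ decays faster than every inverse polynomial in $n$ if and only if $g_n\to\infty$; in particular this happens whenever $g_n$ grows super-logarithmically, $\log n\in o(g_n)$; (c) $v_n\in\Omega(1/n^p)$ for some $p$ if and only if $g_n$ is bounded (for large $n$); (d) if $g_n=2m$ for all large $n$, with $m$ independent of $n$, then $v_n\in\Theta(1/n^m)$, and there is no barren plateau in the sense of (a). -/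

import Mathlib

open MeasureTheory ProbabilityTheory Filter Topology Asymptotics
open scoped Kronecker Matrix

attribute [local instance] LieRing.ofAssociativeRing

/-- Computational basis labels of `n` qubits; `n`-qubit operators are matrices over this index. -/
abbrev Qubits (n : ℕ) : Type := Fin n → Fin 2

/-- `n`-qubit operators. -/
abbrev Op (n : ℕ) : Type := Matrix (Qubits n) (Qubits n) ℂ

/-- Labels of the single-qubit Pauli matrices. -/
inductive Pauli
  | I | X | Y | Z

/-- The single-qubit Pauli matrices. -/
def Pauli.mat : Pauli → Matrix (Fin 2) (Fin 2) ℂ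
  | .I => 1
  | .X => !![0, 1; 1, 0]
  | .Y => !![0, -Complex.I; Complex.I, 0]
  | .Z => !![1, 0; 0, -1]

/-- The Pauli string `p 0 ⊗ p 1 ⊗ ⋯ ⊗ p (n - 1)`. -/
def pauliString {n : ℕ} (p : Fin n → Pauli) : Op n :=
  Matrix.of fun a b => ∏ i, (p i).mat (a i) (b i)

/-- The circuit generator `Z_j`. -/
def zGen {n : ℕ} (j : Fin n) : Op n :=
  pauliString fun i => if i = j then .Z else .I

/-- The circuit generator `X_j X_{j+1}` (used for `j + 1 < n` only). -/
def xxGen {n : ℕ} (j : Fin n) : Op n :=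
  pauliString fun i => if i = j ∨ i.val = j.val + 1 then .X else .I

/-- The Hermitian generators `{Z_j} ∪ {X_j X_{j+1}}` of the matchgate circuits. -/
def matchgateGenerators (n : ℕ) : Set (Op n) :=
  {H | (∃ j : Fin n, H = zGen j) ∨ (∃ j : Fin n, j.val + 1 < n ∧ H = xxGen j)}

/-- The dynamical Lie algebra `𝔤`: the real Lie algebra (for the commutator) generated by `i H`,
`H` a generator. -/
noncomputable def dla (n : ℕ) : LieSubalgebra ℝ (Op n) :=
  LieSubalgebra.lieSpan ℝ (Op n) {A | ∃ H ∈ matchgateGenerators n, A = Complex.I • H}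

/-- The Lie group `G = e^𝔤` inside the unitary group. As `e^𝔤` is itself a compact group
(the image of `Spin(2n)`), generating a subgroup and closing it up adds nothing to it; in this form
`G` is visibly a compact group, so that its Haar measure is available. -/
noncomputable def matchgateGroup (n : ℕ) : Subgroup (Matrix.unitaryGroup (Qubits n) ℂ) :=
  (Subgroup.closure {U : Matrix.unitaryGroup (Qubits n) ℂ |
    ∃ A ∈ dla n, (U : Op n) = NormedSpace.exp A}).topologicalClosure

theorem isCompact_unitaryGroup_set (n : ℕ) :
    IsCompact (Matrix.unitaryGroup (Qubits n) ℂ : Set (Op n)) := by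
  have hb : IsCompact (Set.univ.pi fun _ : Qubits n => Set.univ.pi fun _ : Qubits n =>
      Metric.closedBall (0 : ℂ) 1) :=
    isCompact_univ_pi fun _ => isCompact_univ_pi fun _ => isCompact_closedBall _ _
  refine IsCompact.of_isClosed_subset (X := Qubits n → Qubits n → ℂ) hb ?_ ?_
  · have h : IsClosed {U : Op n | U * star U = 1} :=
      isClosed_eq (by fun_prop) continuous_const
    have e : (Matrix.unitaryGroup (Qubits n) ℂ : Set (Op n)) = {U : Op n | U * star U = 1} := by
      ext U
      exact Matrix.mem_unitaryGroup_iff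
    rw [e]
    exact h
  · intro U hU i _ j _
    simpa using entry_norm_bound_of_unitary hU i j

instance instCompactUnitaryGroup (n : ℕ) : CompactSpace (Matrix.unitaryGroup (Qubits n) ℂ) :=
  isCompact_iff_compactSpace.mp (isCompact_unitaryGroup_set n)

instance instCompactMatchgateGroup (n : ℕ) : CompactSpace (matchgateGroup n) :=
  isCompact_iff_compactSpace.mp
    (Subgroup.isClosed_topologicalClosure _).isCompact

noncomputable instance instMeasurableMatchgateGroup (n : ℕ) : MeasurableSpace (matchgateGroup n) :=
  borel _

instance instBorelMatchgateGroup (n : ℕ) : BorelSpace (matchgateGroup n) :=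
  ⟨rfl⟩

/-- The Haar measure of `G`, normalized to total mass one. -/
noncomputable def haarG (n : ℕ) : Measure (matchgateGroup n) :=
  Measure.haarMeasure ⊤

/-- The operator of a group element. -/
def opOf {n : ℕ} (U : matchgateGroup n) : Op n :=
  ((U : Matrix.unitaryGroup (Qubits n) ℂ) : Op n)

/-- A random matchgate circuit: a probability space of parameters `θ` and a random unitary
`U(θ) ∈ G` that forms a 2-design over `G`, that is, for `t = 1, 2` and all operators `A`, the
averages of `U^{⊗t} A (U^{⊗t})†` over the parameters and over the Haar measure of `G` agree
(entry by entry). -/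
structure MatchgateEnsemble (n : ℕ) where
  Param : Type*
  [meas : MeasurableSpace Param]
  prob : Measure Param
  isProb : IsProbabilityMeasure prob
  U : Param → matchgateGroup n
  measurable_U : Measurable U
  design_one : ∀ (A : Op n) (a b : Qubits n),
    ∫ θ, (opOf (U θ) * A * (opOf (U θ))ᴴ) a b ∂prob =
      ∫ V, (opOf V * A * (opOf V)ᴴ) a b ∂(haarG n)
  design_two : ∀ (A : Matrix (Qubits n × Qubits n) (Qubits n × Qubits n) ℂ)
      (a b : Qubits n × Qubits n),
    ∫ θ, ((opOf (U θ) ⊗ₖ opOf (U θ)) * A * (opOf (U θ) ⊗ₖ opOf (U θ))ᴴ) a b ∂prob =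
      ∫ V, ((opOf V ⊗ₖ opOf V) * A * (opOf V ⊗ₖ opOf V)ᴴ) a b ∂(haarG n)

attribute [instance] MatchgateEnsemble.meas

/-- The loss `Tr[U ρ U† O]`; it is a real number for Hermitian `ρ` and `O`. -/
noncomputable def loss {n : ℕ} (ρ O : Op n) (U : matchgateGroup n) : ℝ :=
  (Matrix.trace (opOf U * ρ * (opOf U)ᴴ * O)).re

/-- The variance of the loss over the parameters of the circuit. -/
noncomputable def MatchgateEnsemble.lossVariance {n : ℕ} (E : MatchgateEnsemble n)
    (ρ O : Op n) : ℝ :=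
  variance (fun θ => loss ρ O (E.U θ)) E.prob

/-- The Majorana operators, numbered from `0`: `Z ⋯ Z X I ⋯ I` with `X` on qubit `j` is number
`2 j`, and `Z ⋯ Z Y I ⋯ I` with `Y` on qubit `j` is number `2 j + 1`. -/
def majorana {n : ℕ} (μ : Fin (2 * n)) : Op n :=
  pauliString fun i =>
    if i.val < μ.val / 2 then .Z
    else if i.val = μ.val / 2 then (if μ.val % 2 = 0 then .X else .Y)
    else .I

/-- The product, in increasing order, of the Majorana operators with index in `S`. -/
def majoranaProd {n : ℕ} (S : Finset (Fin (2 * n))) : Op n :=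
  (S.sort.map majorana).prod

/-- The module `B_κ`, spanned by the products of `κ` distinct Majorana operators. -/
def majoranaModule (n κ : ℕ) : Submodule ℂ (Op n) :=
  Submodule.span ℂ {M | ∃ S : Finset (Fin (2 * n)), S.card = κ ∧ M = majoranaProd S}

/-- The state vector `|0⟩^{⊗n}`. -/
def ket0 (n : ℕ) : Qubits n → ℂ := Pi.single 0 1

/-- The projector `|ψ⟩⟨ψ|`. -/
def ketbra {n : ℕ} (ψ : Qubits n → ℂ) : Op n := Matrix.vecMulVec ψ (star ψ)

/-- Pure fermionic Gaussian states: `|ψ⟩ = U |0⟩` (even parity) or `|ψ⟩ = U c_1 |0⟩` (odd parity)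
with `U ∈ G`. -/
def IsPureGaussian {n : ℕ} (ρ : Op n) : Prop :=
  ∃ U : matchgateGroup n,
    ρ = ketbra (opOf U *ᵥ ket0 n) ∨
    ∃ h : 0 < 2 * n, ρ = ketbra (opOf U *ᵥ (majorana (⟨0, h⟩ : Fin (2 * n)) *ᵥ ket0 n))

/-- Pauli observables: Pauli strings with a sign. -/
def IsPauliObservable {n : ℕ} (O : Op n) : Prop :=
  ∃ p : Fin n → Pauli, O = pauliString p ∨ O = -pauliString p

/-- Observables `V† S V` with `S` a Pauli observable in `B_κ` and `V ∈ G`; for `V = 1` these are the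
Pauli observables in `B_κ` themselves. -/
def IsModulePauli {n : ℕ} (κ : ℕ) (O : Op n) : Prop :=
  ∃ (S : Op n) (V : matchgateGroup n), IsPauliObservable S ∧ S ∈ majoranaModule n κ ∧
    O = (opOf V)ᴴ * S * opOf V

/-- The generalized globality of the module `B_κ`, reduced by the parity symmetry that exchanges
`B_κ` and `B_{2n-κ}`. -/
def globality (n κ : ℕ) : ℕ := min κ (2 * n - κ)

/-- Barren plateau: the variance is in `O(1 / b ^ n)` for some `b > 1`. -/
def HasBarrenPlateau (v : ℕ → ℝ) : Prop :=
  ∃ b : ℝ, 1 < b ∧ v =O[atTop] fun n : ℕ => 1 / b ^ n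

/-! Write `c_T` for the product of the Majorana operators with labels in `T`. Each circuit generator
times `i` is a product `bilin k = c_k c_{k+1}` of neighbours, of square `-1`, so `G` contains every
`cos θ + sin θ • bilin k`. Conjugation at angle `π/2` flips the sign of `c_T` when `T` contains
exactly one of `k`, `k+1`; at angle `π/4` it exchanges these two labels in `T`, up to a phase.

A Pauli observable in `B_κ` is a phase times a single `c_T`. The design property replaces the
parameters by Haar measure, whose invariance absorbs the conjugation by `V` in the observable. For
`0 < κ < 2n` a sign flip makes the mean vanish (`integral_loss_smul_majoranaProd`). Label swaps act
transitively on `κ`-sets, so the second moment of `Tr[U ρ U† c_T]` depends only on `|T|`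
(`integral_norm_sq_trace_eq`). The sum over all `κ`-sets `T` of `|Tr[M c_T]|²` is `Tr[(M ⊗ M)
casimir]`, and `casimir` commutes with `U ⊗ U` (`commute_kronecker_casimir`); hence this sum is
constant in `U` and may be computed at the vacuum. There only unions of pairs `{2j, 2j+1}`
contribute, each with value one, which gives `C(n, κ/2)`; division by the number `C(2n, κ)` of sets
gives the variance.

For the asymptotics, `r(m) = C(n,m) / C(2n,2m)` satisfies `r(m+1) = r(m) (2m+1)/(2n-2m-1)` and
`r(n-m) = r(m)`, so only `m = g/2 ≤ n/2` matters, where the factors leading up to `r(m)` are below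
one. Bounding them gives `m!/(2n)^m ≤ r(m) ≤ (2m/n)^m` and `r(m) ≤ 2^(-⌊m/2⌋)`, from which all the
scaling regimes follow. -/

/-! ### Tensor products and Pauli strings up to phase. -/

/-- The tensor product of a family of single-qubit operators. -/
def tensorOp {n : ℕ} (f : Fin n → Matrix (Fin 2) (Fin 2) ℂ) : Op n :=
  Matrix.of fun a b => ∏ i, f i (a i) (b i)

theorem tensorOp_mul {n : ℕ} (f g : Fin n → Matrix (Fin 2) (Fin 2) ℂ) :
    tensorOp f * tensorOp g = tensorOp fun i => f i * g i := by
  ext a b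
  simp only [tensorOp, Matrix.mul_apply, Matrix.of_apply]
  rw [Finset.prod_univ_sum]
  simp [Finset.prod_mul_distrib]

theorem tensorOp_one {n : ℕ} : tensorOp (fun _ : Fin n => 1) = 1 := by
  ext a b
  simp only [tensorOp, Matrix.of_apply, Matrix.one_apply]
  by_cases h : a = b
  · simp [h]
  · obtain ⟨i, hi⟩ := Function.ne_iff.mp h
    rw [if_neg h]
    exact Finset.prod_eq_zero (Finset.mem_univ i) (if_neg hi)

theorem tensorOp_smul {n : ℕ} (s : Fin n → ℂ) (f : Fin n → Matrix (Fin 2) (Fin 2) ℂ) :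
    tensorOp (fun i => s i • f i) = (∏ i, s i) • tensorOp f := by
  ext a b
  simp [tensorOp, Finset.prod_mul_distrib]

theorem tensorOp_conjTranspose {n : ℕ} (f : Fin n → Matrix (Fin 2) (Fin 2) ℂ) :
    (tensorOp f)ᴴ = tensorOp fun i => (f i)ᴴ := by
  ext a b
  simp [tensorOp]

theorem trace_tensorOp {n : ℕ} (f : Fin n → Matrix (Fin 2) (Fin 2) ℂ) :
    (tensorOp f).trace = ∏ i, (f i).trace := by
  simp only [Matrix.trace, tensorOp, Matrix.diag_apply, Matrix.of_apply]
  rw [Finset.prod_univ_sum]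
  simp

theorem pauliString_eq_tensorOp {n : ℕ} (p : Fin n → Pauli) :
    pauliString p = tensorOp fun i => (p i).mat := rfl

theorem Pauli.mat_mul_self (p : Pauli) : p.mat * p.mat = 1 := by
  cases p <;> ext i j <;> fin_cases i <;> fin_cases j <;> simp [Pauli.mat]

theorem Pauli.mat_conjTranspose (p : Pauli) : p.matᴴ = p.mat := by
  cases p <;> ext i j <;> fin_cases i <;> fin_cases j <;> simp [Pauli.mat]

theorem Pauli.trace_mat (p : Pauli) : p.mat.trace = 0 ∨ p = .I := by
  cases p <;> simp [Pauli.mat, Matrix.trace_fin_two]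

theorem Pauli.exists_mat_mul (p q : Pauli) :
    ∃ (z : ℂ) (r : Pauli), ‖z‖ = 1 ∧ p.mat * q.mat = z • r.mat := by
  cases p <;> cases q
  case I.I => exact ⟨1, .I, by simp, by simp [Pauli.mat]⟩
  case I.X => exact ⟨1, .X, by simp, by simp [Pauli.mat]⟩
  case I.Y => exact ⟨1, .Y, by simp, by simp [Pauli.mat]⟩
  case I.Z => exact ⟨1, .Z, by simp, by simp [Pauli.mat]⟩
  case X.I => exact ⟨1, .X, by simp, by simp [Pauli.mat]⟩
  case Y.I => exact ⟨1, .Y, by simp, by simp [Pauli.mat]⟩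
  case Z.I => exact ⟨1, .Z, by simp, by simp [Pauli.mat]⟩
  case X.X => exact ⟨1, .I, by simp, by rw [Pauli.mat_mul_self]; simp [Pauli.mat]⟩
  case Y.Y => exact ⟨1, .I, by simp, by rw [Pauli.mat_mul_self]; simp [Pauli.mat]⟩
  case Z.Z => exact ⟨1, .I, by simp, by rw [Pauli.mat_mul_self]; simp [Pauli.mat]⟩
  case X.Y => exact ⟨Complex.I, .Z, by simp, by simp [Pauli.mat]⟩
  case Y.X => exact ⟨-Complex.I, .Z, by simp, by simp [Pauli.mat]⟩
  case Y.Z => exact ⟨Complex.I, .X, by simp, by simp [Pauli.mat]⟩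
  case Z.Y => exact ⟨-Complex.I, .X, by simp, by simp [Pauli.mat]⟩
  case Z.X => exact ⟨Complex.I, .Y, by simp, by simp [Pauli.mat]⟩
  case X.Z => exact ⟨-Complex.I, .Y, by simp, by simp [Pauli.mat]⟩

theorem pauliString_mul_self {n : ℕ} (p : Fin n → Pauli) : pauliString p * pauliString p = 1 := by
  simp [pauliString_eq_tensorOp, tensorOp_mul, Pauli.mat_mul_self, tensorOp_one]

theorem pauliString_conjTranspose {n : ℕ} (p : Fin n → Pauli) :
    (pauliString p)ᴴ = pauliString p := by
  simp [pauliString_eq_tensorOp, tensorOp_conjTranspose, Pauli.mat_conjTranspose]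

/-- Pauli strings up to a phase. -/
def IsPhasedPauli {n : ℕ} (M : Op n) : Prop :=
  ∃ (z : ℂ) (p : Fin n → Pauli), ‖z‖ = 1 ∧ M = z • pauliString p

theorem isPhasedPauli_pauliString {n : ℕ} (p : Fin n → Pauli) : IsPhasedPauli (pauliString p) :=
  ⟨1, p, by simp, by simp⟩

theorem isPhasedPauli_one {n : ℕ} : IsPhasedPauli (1 : Op n) :=
  ⟨1, fun _ => .I, by simp, by simp [pauliString_eq_tensorOp, Pauli.mat, tensorOp_one]⟩

theorem IsPhasedPauli.mul {n : ℕ} {M N : Op n} (hM : IsPhasedPauli M) (hN : IsPhasedPauli N) :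
    IsPhasedPauli (M * N) := by
  obtain ⟨z, p, hz, rfl⟩ := hM
  obtain ⟨w, q, hw, rfl⟩ := hN
  choose s r hs hr using fun i => Pauli.exists_mat_mul (p i) (q i)
  refine ⟨z * w * ∏ i, s i, r, by simp [hz, hw, hs, norm_prod], ?_⟩
  rw [smul_mul_smul_comm, pauliString_eq_tensorOp, pauliString_eq_tensorOp, tensorOp_mul,
    funext hr, tensorOp_smul, smul_smul, pauliString_eq_tensorOp]

/-- The trace is multiplicative over qubits and vanishes on `X`, `Y` and `Z`, so a single nontrivial
factor would kill it. -/
theorem IsPhasedPauli.eq_smul_one_of_trace_ne_zero {n : ℕ} {M : Op n} (hM : IsPhasedPauli M)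
    (h : M.trace ≠ 0) : ∃ z : ℂ, ‖z‖ = 1 ∧ M = z • 1 := by
  obtain ⟨z, p, hz, rfl⟩ := hM
  refine ⟨z, hz, ?_⟩
  have hp : ∀ i, p i = .I := by
    intro i
    refine (Pauli.trace_mat (p i)).resolve_left fun hi => h ?_
    rw [Matrix.trace_smul, pauliString_eq_tensorOp, trace_tensorOp,
      Finset.prod_eq_zero (Finset.mem_univ i) hi, smul_zero]
  simp [pauliString_eq_tensorOp, hp, Pauli.mat, tensorOp_one]

/-! ### Majorana products and the quadratic generators. -/

section Majorana

variable {n : ℕ}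

theorem majorana_mul_self (μ : Fin (2 * n)) : (majorana μ : Op n) * majorana μ = 1 :=
  pauliString_mul_self _

theorem majorana_conjTranspose (μ : Fin (2 * n)) : (majorana μ : Op n)ᴴ = majorana μ :=
  pauliString_conjTranspose _

/-- On the qubit of `μ` the strings anticommute: `X` or `Y` meets `Z`, or `X` meets `Y` if both
labels share the qubit. On every other qubit the factors commute. -/
theorem majorana_anticomm_of_lt {μ ν : Fin (2 * n)} (h : μ < ν) :
    (majorana μ : Op n) * majorana ν = -(majorana ν * majorana μ) := by
  have hμ : μ.val / 2 < n := by omega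
  -- The sign is spread as a product over qubits, so that the identity can be checked one qubit at a
  -- time.
  have hs : ∏ i : Fin n, (if i = ⟨μ.val / 2, hμ⟩ then (-1 : ℂ) else 1) = -1 := by simp
  have h' : μ.val < ν.val := h
  rw [← neg_one_smul ℂ, ← hs]
  unfold majorana
  rw [pauliString_eq_tensorOp, pauliString_eq_tensorOp, tensorOp_mul, tensorOp_mul, ← tensorOp_smul]
  congr 1
  funext i
  simp only [Fin.ext_iff]
  rcases lt_trichotomy i.val (μ.val / 2) with hi | hi | hi
  · have : i.val < ν.val / 2 := by omega
    simp [hi, hi.ne, this]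
  · rcases Nat.lt_or_ge (μ.val / 2) (ν.val / 2) with h2 | h2
    · split_ifs <;> first | omega | simp [Pauli.mat]
    · have h3 : μ.val % 2 = 0 := by omega
      have h4 : ν.val % 2 = 1 := by omega
      have h5 : ν.val / 2 = μ.val / 2 := by omega
      simp [hi, h3, h4, h5, Pauli.mat]
  · have h1 : ¬ i.val < μ.val / 2 := by omega
    have h2 : ¬ i.val = μ.val / 2 := by omega
    simp [h1, h2, Pauli.mat]

theorem majorana_anticomm {μ ν : Fin (2 * n)} (h : μ ≠ ν) :
    (majorana μ : Op n) * majorana ν = -(majorana ν * majorana μ) := by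
  rcases lt_or_gt_of_ne h with h | h
  · exact majorana_anticomm_of_lt h
  · rw [majorana_anticomm_of_lt h, neg_neg]

theorem majorana_mul_list_prod (a : Fin (2 * n)) (l : List (Fin (2 * n))) :
    (majorana a : Op n) * (l.map majorana).prod =
      (-1 : ℂ) ^ (l.countP (· ≠ a)) • ((l.map majorana).prod * majorana a) := by
  induction l with
  | nil => simp
  | cons x l ih =>
    simp only [List.map_cons, List.prod_cons]
    by_cases hx : x = a
    · subst hx
      rw [List.countP_cons_of_neg (by simp), mul_assoc, ← mul_smul_comm, ← ih]
    · rw [List.countP_cons_of_pos (by simpa using hx), ← mul_assoc, majorana_anticomm (Ne.symm hx),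
        neg_mul, mul_assoc, ih, pow_succ, mul_smul_comm]
      simp [mul_assoc]

theorem majorana_mul_majoranaProd (a : Fin (2 * n)) (T : Finset (Fin (2 * n))) :
    (majorana a : Op n) * majoranaProd T =
      (-1 : ℂ) ^ (T.erase a).card • (majoranaProd T * majorana a) := by
  rw [majoranaProd, majorana_mul_list_prod]
  congr 2
  rw [(T.sort_perm_toList _).countP_eq, List.countP_eq_length_filter,
    ← List.toFinset_card_of_nodup (T.nodup_toList.filter _)]
  congr 1
  ext x
  simp [and_comm]

theorem majoranaProd_singleton (a : Fin (2 * n)) : (majoranaProd {a} : Op n) = majorana a := by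
  simp [majoranaProd]

theorem majoranaProd_union {S T : Finset (Fin (2 * n))} (h : ∀ x ∈ S, ∀ y ∈ T, x < y) :
    (majoranaProd (S ∪ T) : Op n) = majoranaProd S * majoranaProd T := by
  have hl : (S ∪ T).sort = S.sort ++ T.sort := by
    refine List.Perm.eq_of_pairwise (le := (· ≤ ·)) (fun a b _ _ => le_antisymm)
      (Finset.pairwise_sort _ _) ?_ ?_
    · rw [List.pairwise_append]
      refine ⟨Finset.pairwise_sort _ _, Finset.pairwise_sort _ _, fun x hx y hy => ?_⟩
      exact (h x (by simpa using hx) y (by simpa using hy)).le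
    · refine List.perm_of_nodup_nodup_toFinset_eq (Finset.sort_nodup _ _) ?_ (by ext; simp)
      refine List.Nodup.append (Finset.sort_nodup _ _) (Finset.sort_nodup _ _) fun x hx hy => ?_
      exact (h x (by simpa using hx) x (by simpa using hy)).false
  simp [majoranaProd, hl]

theorem isPhasedPauli_majoranaProd (T : Finset (Fin (2 * n))) :
    IsPhasedPauli (majoranaProd T : Op n) := by
  unfold majoranaProd
  induction T.sort with
  | nil => exact isPhasedPauli_one
  | cons x l ih => exact (isPhasedPauli_pauliString _).mul ih

/-- The quadratic operators `c_k c_{k+1}`, which are `i` times the circuit generators. -/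
def bilin (k : ℕ) (hk : k + 1 < 2 * n) : Op n :=
  majorana ⟨k, Nat.lt_of_succ_lt hk⟩ * majorana ⟨k + 1, hk⟩

theorem bilin_mul_self (k : ℕ) (hk : k + 1 < 2 * n) : (bilin k hk : Op n) * bilin k hk = -1 := by
  unfold bilin
  have h := majorana_anticomm (n := n) (μ := ⟨k + 1, hk⟩) (ν := ⟨k, Nat.lt_of_succ_lt hk⟩)
    (by simp)
  rw [mul_assoc, ← mul_assoc (majorana ⟨k + 1, hk⟩), h, neg_mul, mul_assoc, majorana_mul_self,
    mul_one, mul_neg, majorana_mul_self]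

theorem bilin_conjTranspose (k : ℕ) (hk : k + 1 < 2 * n) :
    (bilin k hk : Op n)ᴴ = -bilin k hk := by
  unfold bilin
  rw [Matrix.conjTranspose_mul, majorana_conjTranspose, majorana_conjTranspose,
    majorana_anticomm (by simp)]

/-- The `Z` tails square to one and `XY = iZ` remains; in `bilin_odd` the corresponding identity is
`YZ = iX`. -/
theorem bilin_even (j : Fin n) :
    (bilin (2 * j.val) (by omega) : Op n) = Complex.I • zGen j := by
  have hs : ∏ i : Fin n, (if i = j then Complex.I else 1) = Complex.I := by simp
  nth_rw 1 [← hs]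
  unfold bilin majorana zGen
  rw [pauliString_eq_tensorOp, pauliString_eq_tensorOp, pauliString_eq_tensorOp, tensorOp_mul,
    ← tensorOp_smul]
  congr 1
  funext i
  have h1 : 2 * j.val / 2 = j.val := by omega
  have h2 : (2 * j.val + 1) / 2 = j.val := by omega
  simp only [h1, h2, Fin.ext_iff]
  rcases lt_trichotomy i.val j.val with hi | hi | hi
  · simp [hi, hi.ne, Pauli.mat_mul_self, show Pauli.I.mat = 1 from rfl]
  · simp [hi, Pauli.mat]
  · simp [hi.ne', hi.not_gt, Pauli.mat]

theorem bilin_odd (j : Fin n) (hj : j.val + 1 < n) :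
    (bilin (2 * j.val + 1) (by omega) : Op n) = Complex.I • xxGen j := by
  have hs : ∏ i : Fin n, (if i = j then Complex.I else 1) = Complex.I := by simp
  nth_rw 1 [← hs]
  unfold bilin majorana xxGen
  rw [pauliString_eq_tensorOp, pauliString_eq_tensorOp, pauliString_eq_tensorOp, tensorOp_mul,
    ← tensorOp_smul]
  congr 1
  funext i
  have h1 : (2 * j.val + 1) / 2 = j.val := by omega
  have h2 : (2 * j.val + 1 + 1) / 2 = j.val + 1 := by omega
  have h3 : (2 * j.val + 1) % 2 = 1 := by omega
  have h4 : (2 * j.val + 1 + 1) % 2 = 0 := by omega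
  simp only [h1, h2, h3, h4, Fin.ext_iff]
  rcases lt_trichotomy i.val j.val with hi | hi | hi
  · have h5 : i.val < j.val + 1 := by omega
    simp [hi, hi.ne, h5, h5.ne, Pauli.mat_mul_self, show Pauli.I.mat = 1 from rfl]
  · simp [hi, Pauli.mat]
  · rcases eq_or_ne i.val (j.val + 1) with h5 | h5
    · simp [h5, Pauli.mat]
    · have h6 : ¬ i.val < j.val + 1 := by omega
      simp [hi.ne', hi.not_gt, h5, h6, Pauli.mat]

/-- The exponent is even exactly when `T` contains both or neither of the labels `k`, `k + 1`. -/
theorem bilin_mul_majoranaProd (k : ℕ) (hk : k + 1 < 2 * n) (T : Finset (Fin (2 * n))) :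
    (bilin k hk : Op n) * majoranaProd T =
      (-1 : ℂ) ^ ((T.erase ⟨k, Nat.lt_of_succ_lt hk⟩).card + (T.erase ⟨k + 1, hk⟩).card) •
        (majoranaProd T * bilin k hk) := by
  unfold bilin
  rw [mul_assoc, majorana_mul_majoranaProd, mul_smul_comm, ← mul_assoc, majorana_mul_majoranaProd,
    smul_mul_assoc, smul_smul, mul_assoc, ← pow_add, add_comm]

theorem bilin_comm_majoranaProd {k : ℕ} {hk : k + 1 < 2 * n} {T : Finset (Fin (2 * n))}
    (h : ⟨k, Nat.lt_of_succ_lt hk⟩ ∈ T ↔ ⟨k + 1, hk⟩ ∈ T) :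
    (bilin k hk : Op n) * majoranaProd T = majoranaProd T * bilin k hk := by
  rw [bilin_mul_majoranaProd, Even.neg_one_pow, one_smul]
  simp only [Finset.card_erase_eq_ite, h]
  exact ⟨_, rfl⟩

theorem bilin_anticomm_majoranaProd {k : ℕ} {hk : k + 1 < 2 * n} {T : Finset (Fin (2 * n))}
    (h : ¬ (⟨k, Nat.lt_of_succ_lt hk⟩ ∈ T ↔ ⟨k + 1, hk⟩ ∈ T)) :
    (bilin k hk : Op n) * majoranaProd T = -(majoranaProd T * bilin k hk) := by
  rw [bilin_mul_majoranaProd, Odd.neg_one_pow, neg_one_smul]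
  have hT : 0 < T.card := by
    rw [Finset.card_pos]
    by_contra h'
    simp_all
  by_cases h1 : (⟨k, Nat.lt_of_succ_lt hk⟩ : Fin (2 * n)) ∈ T <;>
    by_cases h2 : (⟨k + 1, hk⟩ : Fin (2 * n)) ∈ T <;>
    simp only [h1, h2, not_true_eq_false, iff_true, iff_false, not_false_eq_true] at h
  · rw [Finset.card_erase_of_mem h1, Finset.erase_eq_of_notMem h2]
    exact ⟨T.card - 1, by omega⟩
  · rw [Finset.card_erase_of_mem h2, Finset.erase_eq_of_notMem h1]
    exact ⟨T.card - 1, by omega⟩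

/-- Exchange of the indices `k` and `k + 1` in a set of Majorana labels. -/
def swapSet (k : ℕ) (hk : k + 1 < 2 * n) (T : Finset (Fin (2 * n))) : Finset (Fin (2 * n)) :=
  T.map (Equiv.swap (⟨k, Nat.lt_of_succ_lt hk⟩ : Fin (2 * n)) ⟨k + 1, hk⟩).toEmbedding

theorem mem_swapSet {k : ℕ} {hk : k + 1 < 2 * n} {T : Finset (Fin (2 * n))} {x : Fin (2 * n)} :
    x ∈ swapSet k hk T ↔
      Equiv.swap (⟨k, Nat.lt_of_succ_lt hk⟩ : Fin (2 * n)) ⟨k + 1, hk⟩ x ∈ T := by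
  simp [swapSet, Finset.mem_map_equiv]

theorem card_swapSet (k : ℕ) (hk : k + 1 < 2 * n) (T : Finset (Fin (2 * n))) :
    (swapSet k hk T).card = T.card := Finset.card_map _

theorem swapSet_swapSet (k : ℕ) (hk : k + 1 < 2 * n) (T : Finset (Fin (2 * n))) :
    swapSet k hk (swapSet k hk T) = T := by
  ext x
  simp [mem_swapSet]

theorem swapSet_eq_self {k : ℕ} {hk : k + 1 < 2 * n} {T : Finset (Fin (2 * n))}
    (h : ⟨k, Nat.lt_of_succ_lt hk⟩ ∈ T ↔ ⟨k + 1, hk⟩ ∈ T) : swapSet k hk T = T := by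
  ext x
  rw [mem_swapSet]
  rcases eq_or_ne x ⟨k, Nat.lt_of_succ_lt hk⟩ with rfl | h1
  · simp [h]
  rcases eq_or_ne x ⟨k + 1, hk⟩ with rfl | h2
  · simp [h]
  rw [Equiv.swap_apply_of_ne_of_ne h1 h2]

/-- No label lies between `k` and `k + 1`, so the replacement keeps the product sorted. The factor
below `k` commutes with `bilin k`, and `c_k c_{k+1} c_k = -c_{k+1}` does the rest. -/
theorem bilin_mul_majoranaProd_of_mem {k : ℕ} {hk : k + 1 < 2 * n} {T : Finset (Fin (2 * n))}
    (h1 : ⟨k, Nat.lt_of_succ_lt hk⟩ ∈ T) (h2 : ⟨k + 1, hk⟩ ∉ T) :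
    (bilin k hk : Op n) * majoranaProd T = -majoranaProd (swapSet k hk T) := by
  set a : Fin (2 * n) := ⟨k, Nat.lt_of_succ_lt hk⟩ with ha
  set b : Fin (2 * n) := ⟨k + 1, hk⟩ with hb
  set S := T.filter (· < a) with hS
  set R := T.filter (b < ·) with hR
  have hval : ∀ x : Fin (2 * n), (x < a ↔ x.val < k) ∧ (b < x ↔ k + 1 < x.val) := fun x => by
    simp [ha, hb, Fin.lt_def]
  have e1 : T = S ∪ ({a} ∪ R) := by
    ext x
    simp only [hS, hR, Finset.mem_union, Finset.mem_filter, Finset.mem_singleton, hval]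
    constructor
    · intro hx
      have : x ≠ b := fun h => h2 (h ▸ hx)
      simp only [ha, hb, ne_eq, Fin.ext_iff, hx, true_and] at this ⊢
      omega
    · rintro (h | rfl | h)
      exacts [h.1, h1, h.1]
  have e2 : swapSet k hk T = S ∪ ({b} ∪ R) := by
    ext x
    rw [mem_swapSet]
    rcases eq_or_ne x a with rfl | hxa
    · simpa [hS, hR, ha, hb] using h2
    rcases eq_or_ne x b with rfl | hxb
    · simpa [hb] using h1
    rw [Equiv.swap_apply_of_ne_of_ne hxa hxb]
    nth_rw 1 [e1]
    simp [hxa, hxb]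
  have hS1 : ∀ c : Fin (2 * n), k ≤ c.val → c.val ≤ k + 1 → ∀ x ∈ S, ∀ y ∈ {c} ∪ R, x < y := by
    intro c hc _ x hx y hy
    simp only [hS, hR, Finset.mem_union, Finset.mem_filter, Finset.mem_singleton, hval] at hx hy
    rw [Fin.lt_def]
    rcases hy with rfl | hy <;> omega
  have hR1 : ∀ c : Fin (2 * n), c.val ≤ k + 1 → ∀ x ∈ ({c} : Finset (Fin (2 * n))), ∀ y ∈ R,
      x < y := by
    intro c hc x hx y hy
    simp only [hR, Finset.mem_filter, Finset.mem_singleton, hval] at hx hy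
    rw [Fin.lt_def, hx]
    omega
  have c1 : (bilin k hk : Op n) * majoranaProd S = majoranaProd S * bilin k hk := by
    refine bilin_comm_majoranaProd (iff_of_false ?_ ?_) <;> simp [hS, ha]
  have c2 : (bilin k hk : Op n) * majorana a = -majorana b := by
    rw [bilin, mul_assoc, majorana_anticomm (μ := ⟨k + 1, hk⟩) (by simp [ha]), ← ha, mul_neg,
      ← mul_assoc, majorana_mul_self, one_mul]
  rw [e2, majoranaProd_union (hS1 b (by simp [hb]) (by simp [hb])),
    majoranaProd_union (hR1 b (by simp [hb]))]
  nth_rw 1 [e1]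
  rw [majoranaProd_union (hS1 a (by simp [ha]) (by simp [ha])),
    majoranaProd_union (hR1 a (by simp [ha])), majoranaProd_singleton, majoranaProd_singleton,
    ← mul_assoc, c1, mul_assoc, ← mul_assoc (bilin k hk), c2, neg_mul, mul_neg]

theorem bilin_mul_majoranaProd_swap {k : ℕ} {hk : k + 1 < 2 * n} {T : Finset (Fin (2 * n))}
    (h : ¬ (⟨k, Nat.lt_of_succ_lt hk⟩ ∈ T ↔ ⟨k + 1, hk⟩ ∈ T)) :
    (bilin k hk : Op n) * majoranaProd T =
      (if ⟨k, Nat.lt_of_succ_lt hk⟩ ∈ T then (-1 : ℂ) else 1) • majoranaProd (swapSet k hk T) := by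
  by_cases h1 : (⟨k, Nat.lt_of_succ_lt hk⟩ : Fin (2 * n)) ∈ T
  · rw [if_pos h1, neg_one_smul]
    exact bilin_mul_majoranaProd_of_mem h1 (by tauto)
  · rw [if_neg h1, one_smul]
    -- The swapped set falls under the previous case; multiplying that identity by `bilin k`, of
    -- square `-1`, inverts it.
    have h3 := bilin_mul_majoranaProd_of_mem (k := k) (hk := hk) (T := swapSet k hk T)
      (by simp [mem_swapSet]; tauto) (by simpa [mem_swapSet] using h1)
    rw [swapSet_swapSet] at h3
    rw [← neg_neg (majoranaProd T), ← h3, mul_neg, ← mul_assoc, bilin_mul_self]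
    simp

end Majorana

theorem Matrix.eq_zero_of_eq_neg {ι : Type*} {M : Matrix ι ι ℂ} (h : M = -M) : M = 0 := by
  ext i j
  exact self_eq_neg.mp (congrFun (congrFun h i) j)

/-! ### Pauli observables in `B_κ`. -/

section Observables

variable {n : ℕ}

theorem IsPauliObservable.conjTranspose {O : Op n} (h : IsPauliObservable O) : Oᴴ = O := by
  obtain ⟨p, rfl | rfl⟩ := h
  · exact pauliString_conjTranspose p
  · rw [Matrix.conjTranspose_neg, pauliString_conjTranspose]

theorem IsPauliObservable.mul_self {O : Op n} (h : IsPauliObservable O) : O * O = 1 := by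
  obtain ⟨p, rfl | rfl⟩ := h
  · exact pauliString_mul_self p
  · rw [neg_mul_neg, pauliString_mul_self]

theorem IsPauliObservable.isPhasedPauli {O : Op n} (h : IsPauliObservable O) :
    IsPhasedPauli O := by
  obtain ⟨p, rfl | rfl⟩ := h
  · exact isPhasedPauli_pauliString p
  · exact ⟨-1, p, by simp, by simp⟩

/-- Since `Tr[O O] ≠ 0` and `O` lies in the span, some `Tr[O c_T]` is nonzero. But `O c_T` is a
phased Pauli string, hence a scalar, and `O` is its own inverse. -/
theorem IsPauliObservable.eq_smul_majoranaProd {O : Op n} {κ : ℕ} (h : IsPauliObservable O)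
    (hO : O ∈ majoranaModule n κ) :
    ∃ (T : Finset (Fin (2 * n))) (z : ℂ), T.card = κ ∧ ‖z‖ = 1 ∧ O = z • majoranaProd T := by
  obtain ⟨T, hT, hne⟩ : ∃ T : Finset (Fin (2 * n)), T.card = κ ∧ (O * majoranaProd T).trace ≠ 0 := by
    by_contra! hc
    have hz : ∀ M ∈ majoranaModule n κ, (O * M).trace = 0 := by
      intro M hM
      induction hM using Submodule.span_induction with
      | mem M hM =>
        obtain ⟨T, hT, rfl⟩ := hM
        exact hc T hT
      | zero => simp
      | add M N _ _ hM hN => rw [mul_add, Matrix.trace_add, hM, hN, add_zero]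
      | smul z M _ hM => rw [mul_smul_comm, Matrix.trace_smul, hM, smul_zero]
    have := hz O hO
    rw [h.mul_self, Matrix.trace_one] at this
    simp at this
  obtain ⟨z, hz, he⟩ :=
    (h.isPhasedPauli.mul (isPhasedPauli_majoranaProd T)).eq_smul_one_of_trace_ne_zero hne
  have hz0 : z ≠ 0 := fun h0 => by simp [h0] at hz
  refine ⟨T, z⁻¹, hT, by simp [hz], ?_⟩
  have h2 : majoranaProd T = z • O := by
    have := congrArg (O * ·) he
    simpa [← mul_assoc, h.mul_self] using this
  rw [h2, smul_smul, inv_mul_cancel₀ hz0, one_smul]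

end Observables

/-! ### Vacuum expectation values of Majorana products. -/

section Vacuum

variable {n : ℕ}

theorem zGen_zero_left (j : Fin n) (x : Qubits n) : (zGen j : Op n) 0 x = (1 : Op n) 0 x := by
  rw [← tensorOp_one]
  simp only [zGen, pauliString, tensorOp, Matrix.of_apply]
  refine Finset.prod_congr rfl fun i _ => ?_
  split_ifs
  · have h : ∀ y : Fin 2, Pauli.Z.mat 0 y = (1 : Matrix (Fin 2) (Fin 2) ℂ) 0 y := by
      simp [Fin.forall_fin_two, Pauli.mat]
    exact h (x i)
  · rfl

theorem zGen_zero_right (j : Fin n) (x : Qubits n) : (zGen j : Op n) x 0 = (1 : Op n) x 0 := by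
  rw [← tensorOp_one]
  simp only [zGen, pauliString, tensorOp, Matrix.of_apply]
  refine Finset.prod_congr rfl fun i _ => ?_
  split_ifs
  · have h : ∀ y : Fin 2, Pauli.Z.mat y 0 = (1 : Matrix (Fin 2) (Fin 2) ℂ) y 0 := by
      simp [Fin.forall_fin_two, Pauli.mat]
    exact h (x i)
  · rfl

theorem zGen_mul_apply_zero (j : Fin n) (M : Op n) : (zGen j * M) 0 0 = M 0 0 := by
  rw [← one_mul M, ← mul_assoc, Matrix.mul_apply, Matrix.mul_apply]
  simp [zGen_zero_left]

theorem mul_zGen_apply_zero (j : Fin n) (M : Op n) : (M * zGen j) 0 0 = M 0 0 := by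
  rw [← mul_one M, mul_assoc, Matrix.mul_apply, Matrix.mul_apply]
  simp [zGen_zero_right]

/-- Sets of Majorana labels that contain both or none of the two labels of each qubit. -/
def IsPaired (T : Finset (Fin (2 * n))) : Prop :=
  ∀ j : Fin n, (⟨2 * j.val, by omega⟩ : Fin (2 * n)) ∈ T ↔
    (⟨2 * j.val + 1, by omega⟩ : Fin (2 * n)) ∈ T

theorem zGen_eq_smul_bilin (j : Fin n) :
    (zGen j : Op n) = (-Complex.I) • bilin (2 * j.val) (by omega) := by
  rw [bilin_even, smul_smul]
  simp

/-- `Z_j` fixes the vacuum but anticommutes with `c_T` when `T` splits the pair of qubit `j`, so the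
expectation equals its negative. -/
theorem majoranaProd_apply_zero_of_not_isPaired {T : Finset (Fin (2 * n))} (h : ¬ IsPaired T) :
    (majoranaProd T : Op n) 0 0 = 0 := by
  unfold IsPaired at h
  push Not at h
  obtain ⟨j, hj⟩ := h
  have h1 : (zGen j : Op n) * majoranaProd T = -(majoranaProd T * zGen j) := by
    rw [zGen_eq_smul_bilin, smul_mul_assoc, bilin_anticomm_majoranaProd (by tauto), mul_smul_comm,
      smul_neg]
  have h2 := congrFun (congrFun h1 0) 0
  rw [Matrix.neg_apply, zGen_mul_apply_zero, mul_zGen_apply_zero] at h2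
  exact self_eq_neg.mp h2

theorem zGen_anticomm_pauliString {p : Fin n → Pauli} {j : Fin n}
    (h : p j = .X ∨ p j = .Y) :
    zGen j * pauliString p = -(pauliString p * zGen j) := by
  have hs : ∏ i : Fin n, (if i = j then (-1 : ℂ) else 1) = -1 := by simp
  rw [← neg_one_smul ℂ, ← hs]
  unfold zGen
  rw [pauliString_eq_tensorOp, pauliString_eq_tensorOp, tensorOp_mul, tensorOp_mul, ← tensorOp_smul]
  congr 1
  funext i
  by_cases hi : i = j
  · subst hi
    rcases h with h | h <;> simp [h, Pauli.mat]
  · simp [hi, Pauli.mat]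

/-- Here `c_T` commutes with every `Z_j`, so its Pauli string has only factors `I` and `Z`, which
fix the vacuum. -/
theorem norm_majoranaProd_apply_zero_of_isPaired {T : Finset (Fin (2 * n))} (h : IsPaired T) :
    ‖(majoranaProd T : Op n) 0 0‖ = 1 := by
  obtain ⟨z, p, hz, he⟩ := isPhasedPauli_majoranaProd T
  have hz0 : z ≠ 0 := fun h0 => by simp [h0] at hz
  have hp : ∀ j, ¬ (p j = .X ∨ p j = .Y) := by
    intro j hj
    have h1 : (zGen j : Op n) * majoranaProd T = majoranaProd T * zGen j := by
      rw [zGen_eq_smul_bilin, smul_mul_assoc, bilin_comm_majoranaProd (h j), mul_smul_comm]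
    rw [he, mul_smul_comm, zGen_anticomm_pauliString hj, smul_mul_assoc, smul_neg] at h1
    have h2 : pauliString p * zGen j = 0 :=
      (smul_eq_zero.mp (Matrix.eq_zero_of_eq_neg h1.symm)).resolve_left hz0
    have h3 : (1 : Op n) = 0 := by
      calc (1 : Op n) = pauliString p * (pauliString p * zGen j) * zGen j := by
            rw [← mul_assoc, pauliString_mul_self, one_mul, zGen, pauliString_mul_self]
        _ = 0 := by rw [h2, mul_zero, zero_mul]
    exact one_ne_zero h3
  have hone : pauliString p 0 0 = 1 := by
    simp only [pauliString, Matrix.of_apply]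
    refine Finset.prod_eq_one fun i _ => ?_
    have := hp i
    cases hpi : p i <;> simp_all [Pauli.mat]
  rw [he, Matrix.smul_apply, hone, smul_eq_mul, mul_one, hz]

theorem ketbra_mulVec (A : Op n) (ψ : Qubits n → ℂ) :
    ketbra (A *ᵥ ψ) = A * ketbra ψ * Aᴴ := by
  simp only [ketbra]
  rw [Matrix.star_mulVec, Matrix.mul_vecMulVec, Matrix.vecMulVec_mul]

theorem ketbra_conjTranspose (ψ : Qubits n → ℂ) : (ketbra ψ : Op n)ᴴ = ketbra ψ := by
  simp [ketbra, Matrix.conjTranspose_vecMulVec]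

theorem trace_ketbra_ket0_mul (M : Op n) : (ketbra (ket0 n) * M).trace = M 0 0 := by
  rw [ketbra, Matrix.trace_mul_comm, Matrix.mul_vecMulVec, Matrix.trace_vecMulVec]
  simp [ket0, dotProduct, Pi.single_apply, Matrix.mulVec]

/-- Conjugation by one Majorana operator changes `c_T` only by a sign; this reduces the odd Gaussian
states to the vacuum. -/
theorem norm_trace_ketbra_majorana_mul (a : Fin (2 * n)) (T : Finset (Fin (2 * n))) :
    ‖(ketbra (majorana a *ᵥ ket0 n) * majoranaProd T).trace‖ =
      ‖(ketbra (ket0 n) * majoranaProd T).trace‖ := by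
  rw [ketbra_mulVec, majorana_conjTranspose, mul_assoc, majorana_mul_majoranaProd, mul_smul_comm,
    Matrix.trace_smul, ← mul_assoc, Matrix.trace_mul_comm, ← mul_assoc, ← mul_assoc,
    majorana_mul_self, one_mul, norm_smul]
  simp

theorem card_paired (κ : ℕ) (hκ : Even κ) [DecidablePred (IsPaired (n := n))] :
    ((Finset.powersetCard κ (Finset.univ : Finset (Fin (2 * n)))).filter IsPaired).card =
      n.choose (κ / 2) := by
  have hn : (Finset.powersetCard (κ / 2) (Finset.univ : Finset (Fin n))).card = n.choose (κ / 2) := by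
    simp
  rw [← hn]
  -- `π` sends a label to its qubit and `ι` a qubit to its even label. The paired sets are the
  -- preimages under `π` of sets of qubits, and taking the preimage doubles the cardinality.
  let π : Fin (2 * n) → Fin n := fun x => ⟨x.val / 2, by omega⟩
  let ι : Fin n → Fin (2 * n) := fun j => ⟨2 * j.val, by omega⟩
  have hcard : ∀ A : Finset (Fin n), (Finset.univ.filter fun x => π x ∈ A).card = 2 * A.card := by
    intro A
    rw [Finset.card_eq_sum_card_fiberwise (f := π) (t := A) (by intro x hx; simpa using hx),
      Finset.sum_const_nat (m := 2), mul_comm]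
    intro j hj
    have : (Finset.filter (fun x => π x = j) (Finset.univ.filter fun x => π x ∈ A)) =
        {⟨2 * j.val, by omega⟩, ⟨2 * j.val + 1, by omega⟩} := by
      ext x
      simp only [Finset.mem_filter, Finset.mem_univ, true_and, Finset.mem_insert,
        Finset.mem_singleton, π, Fin.ext_iff]
      constructor
      · rintro ⟨_, h⟩
        omega
      · intro h
        have hx : (⟨x.val / 2, by omega⟩ : Fin n) = j := Fin.ext (by simp only []; omega)
        rw [hx]
        exact ⟨hj, by omega⟩
    rw [this, Finset.card_pair (by simp)]
  have hpair : ∀ T : Finset (Fin (2 * n)), IsPaired T → ∀ x, ι (π x) ∈ T ↔ x ∈ T := by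
    intro T hT x
    rcases Nat.even_or_odd' x.val with ⟨c, hc | hc⟩
    · have : ι (π x) = x := Fin.ext (by simp only [ι, π]; omega)
      rw [this]
    · have h1 := hT (π x)
      have : (⟨2 * (π x).val + 1, by omega⟩ : Fin (2 * n)) = x :=
        Fin.ext (by simp only [π]; omega)
      rwa [this] at h1
  have hdbl : ∀ T : Finset (Fin (2 * n)), IsPaired T →
      (Finset.univ.filter fun x => π x ∈ Finset.univ.filter fun j => ι j ∈ T) = T := by
    intro T hT
    ext x
    simp [hpair T hT]
  refine Finset.card_nbij' (fun T => Finset.univ.filter fun j => ι j ∈ T)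
    (fun A => Finset.univ.filter fun x => π x ∈ A) ?_ ?_ ?_ ?_
  · intro T hT
    simp only [Finset.coe_filter, Finset.mem_powersetCard, Finset.subset_univ, true_and,
      Set.mem_ofPred_eq, Finset.mem_coe] at hT ⊢
    have := hcard (Finset.univ.filter fun j => ι j ∈ T)
    rw [hdbl T hT.2, hT.1] at this
    omega
  · intro A hA
    simp only [Finset.coe_filter, Finset.mem_powersetCard, Finset.subset_univ, true_and,
      Set.mem_ofPred_eq, Finset.mem_coe] at hA ⊢
    refine ⟨by rw [hcard, hA]; obtain ⟨c, rfl⟩ := hκ; omega, fun j => ?_⟩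
    have h1 : π ⟨2 * j.val, by omega⟩ = j := Fin.ext (by simp only [π]; omega)
    have h2 : π ⟨2 * j.val + 1, by omega⟩ = j := Fin.ext (by simp only [π]; omega)
    simp [h1, h2]
  · intro T hT
    simp only [Finset.coe_filter, Set.mem_ofPred_eq] at hT
    exact hdbl T hT.2
  · intro A _
    ext j
    have h1 : π (ι j) = j := Fin.ext (by simp only [π, ι]; omega)
    simp [h1]

theorem sum_norm_sq_trace_of_norm_eq {κ : ℕ} (hκ : Even κ) {ρ : Op n}
    (h : ∀ T : Finset (Fin (2 * n)), ‖(ρ * majoranaProd T).trace‖ =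
      ‖(ketbra (ket0 n) * majoranaProd T).trace‖) :
    ∑ T ∈ Finset.powersetCard κ (Finset.univ : Finset (Fin (2 * n))),
      ‖(ρ * majoranaProd T).trace‖ ^ 2 = n.choose (κ / 2) := by
  classical
  rw [← card_paired κ hκ, Finset.card_filter, Nat.cast_sum]
  refine Finset.sum_congr rfl fun T _ => ?_
  rw [h, trace_ketbra_ket0_mul]
  split_ifs with hT
  · simp [norm_majoranaProd_apply_zero_of_isPaired hT]
  · simp [majoranaProd_apply_zero_of_not_isPaired hT]

end Vacuum

theorem Matrix.sub_kronecker_of_complex {ι κ : Type*} (A B : Matrix ι ι ℂ) (C : Matrix κ κ ℂ) :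
    (A - B) ⊗ₖ C = A ⊗ₖ C - B ⊗ₖ C := by
  ext
  simp [sub_mul]

theorem Matrix.kronecker_sub_of_complex {ι κ : Type*} (A : Matrix ι ι ℂ) (B C : Matrix κ κ ℂ) :
    A ⊗ₖ (B - C) = A ⊗ₖ B - A ⊗ₖ C := by
  ext
  simp [mul_sub]

/-! ### The invariant tensor and its commutation with `G`. -/

section Group

variable {n : ℕ}

/-- The invariant tensor `∑ c_T ⊗ c_T†` of the module `B_κ`. -/
noncomputable def casimir (n κ : ℕ) : Matrix (Qubits n × Qubits n) (Qubits n × Qubits n) ℂ :=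
  ∑ T ∈ Finset.powersetCard κ (Finset.univ : Finset (Fin (2 * n))),
    (majoranaProd T : Op n) ⊗ₖ (majoranaProd T : Op n)ᴴ

/-- The action of a Lie algebra element on the tensor square. -/
noncomputable def tensorSq (A : Op n) : Matrix (Qubits n × Qubits n) (Qubits n × Qubits n) ℂ :=
  A ⊗ₖ (1 : Op n) + (1 : Op n) ⊗ₖ A

theorem tensorSq_commutator (A B : Op n) :
    tensorSq (A * B - B * A) = tensorSq A * tensorSq B - tensorSq B * tensorSq A := by
  simp only [tensorSq, mul_add, add_mul, ← Matrix.mul_kronecker_mul, one_mul, mul_one,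
    Matrix.sub_kronecker_of_complex, Matrix.kronecker_sub_of_complex]
  abel

/-- The commutator with the term of `T` is a multiple of an expression symmetric in `T` and its
swap, with a coefficient that changes sign under the swap. The terms therefore cancel in pairs. -/
theorem commute_tensorSq_bilin_casimir (k : ℕ) (hk : k + 1 < 2 * n) (κ : ℕ) :
    Commute (tensorSq (bilin k hk : Op n)) (casimir n κ) := by
  set A : Op n := bilin k hk with hA
  set a : Fin (2 * n) := ⟨k, Nat.lt_of_succ_lt hk⟩ with ha
  set b : Fin (2 * n) := ⟨k + 1, hk⟩ with hb
  let c : Finset (Fin (2 * n)) → Op n := majoranaProd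
  -- If `A` anticommutes with `c_T`, the commutator is `2 A c_T`, whence the `±2`; otherwise it
  -- vanishes.
  let s : Finset (Fin (2 * n)) → ℂ := fun T => if a ∈ T ↔ b ∈ T then 0 else if a ∈ T then -2 else 2
  let F : Finset (Fin (2 * n)) → Matrix (Qubits n × Qubits n) (Qubits n × Qubits n) ℂ :=
    fun T => s T • (c (swapSet k hk T) ⊗ₖ (c T)ᴴ + c T ⊗ₖ (c (swapSet k hk T))ᴴ)
  have hcomm : ∀ T, A * c T - c T * A = s T • c (swapSet k hk T) := by
    intro T
    by_cases h : a ∈ T ↔ b ∈ T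
    · simp only [s, if_pos h, zero_smul, sub_eq_zero]
      exact bilin_comm_majoranaProd h
    · have h1 : A * c T = -(c T * A) := bilin_anticomm_majoranaProd h
      have h2 : A * c T = _ := bilin_mul_majoranaProd_swap h
      rw [eq_neg_iff_add_eq_zero, ← eq_neg_iff_add_eq_zero, eq_comm, neg_eq_iff_eq_neg] at h1
      rw [h1, sub_neg_eq_add, h2, ← add_smul]
      simp only [s, if_neg h]
      split_ifs <;> norm_num <;> rfl
  have hterm : ∀ T, tensorSq A * (c T ⊗ₖ (c T)ᴴ) - (c T ⊗ₖ (c T)ᴴ) * tensorSq A = F T := by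
    intro T
    have hs : star (s T) = s T := by simp only [s]; split_ifs <;> simp
    -- As `A` is anti-Hermitian, the adjoint of its commutator with `c_T` is its commutator with
    -- `c_T†`.
    have h2 : A * (c T)ᴴ - (c T)ᴴ * A = s T • (c (swapSet k hk T))ᴴ := by
      have := congrArg Matrix.conjTranspose (hcomm T)
      rw [Matrix.conjTranspose_smul, hs, Matrix.conjTranspose_sub, Matrix.conjTranspose_mul,
        Matrix.conjTranspose_mul, hA, bilin_conjTranspose] at this
      rw [← this]
      noncomm_ring
    have e : tensorSq A * (c T ⊗ₖ (c T)ᴴ) - (c T ⊗ₖ (c T)ᴴ) * tensorSq A =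
        (A * c T - c T * A) ⊗ₖ (c T)ᴴ + c T ⊗ₖ (A * (c T)ᴴ - (c T)ᴴ * A) := by
      simp only [tensorSq, mul_add, add_mul, ← Matrix.mul_kronecker_mul, one_mul, mul_one,
        Matrix.sub_kronecker_of_complex, Matrix.kronecker_sub_of_complex]
      abel
    rw [e, hcomm, h2, Matrix.smul_kronecker, Matrix.kronecker_smul, ← smul_add]
  have hF : ∀ T, F (swapSet k hk T) = -F T := by
    intro T
    have hs : s (swapSet k hk T) = -s T := by
      simp only [s, mem_swapSet, ← ha, ← hb, Equiv.swap_apply_left, Equiv.swap_apply_right]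
      by_cases h1 : a ∈ T <;> by_cases h2 : b ∈ T <;> simp [h1, h2]
    simp only [F, hs, swapSet_swapSet, neg_smul]
    rw [add_comm]
  have hsum : ∑ T ∈ Finset.powersetCard κ (Finset.univ : Finset (Fin (2 * n))), F T = 0 := by
    have h1 : ∑ T ∈ Finset.powersetCard κ (Finset.univ : Finset (Fin (2 * n))), F T =
        ∑ T ∈ Finset.powersetCard κ (Finset.univ : Finset (Fin (2 * n))), F (swapSet k hk T) := by
      refine Finset.sum_nbij' (swapSet k hk) (swapSet k hk) ?_ ?_ ?_ ?_ ?_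
      · intro T hT
        simpa [card_swapSet] using hT
      · intro T hT
        simpa [card_swapSet] using hT
      · intro T _
        exact swapSet_swapSet k hk T
      · intro T _
        exact swapSet_swapSet k hk T
      · intro T _
        rw [swapSet_swapSet]
    rw [Finset.sum_congr rfl fun T _ => hF T, Finset.sum_neg_distrib] at h1
    exact Matrix.eq_zero_of_eq_neg h1
  rw [commute_iff_eq, ← sub_eq_zero, casimir, Finset.mul_sum, Finset.sum_mul,
    ← Finset.sum_sub_distrib, ← hsum]
  exact Finset.sum_congr rfl fun T _ => hterm T

theorem generator_eq_bilin {H : Op n} (h : H ∈ matchgateGenerators n) :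
    ∃ (k : ℕ) (hk : k + 1 < 2 * n), Complex.I • H = bilin k hk := by
  rcases h with ⟨j, rfl⟩ | ⟨j, hj, rfl⟩
  · exact ⟨_, _, (bilin_even j).symm⟩
  · exact ⟨_, _, (bilin_odd j hj).symm⟩

theorem bilin_mem_dla (k : ℕ) (hk : k + 1 < 2 * n) : (bilin k hk : Op n) ∈ dla n := by
  apply LieSubalgebra.subset_lieSpan
  rcases Nat.even_or_odd' k with ⟨j, rfl | rfl⟩
  · exact ⟨_, Or.inl ⟨⟨j, by omega⟩, rfl⟩, bilin_even ⟨j, by omega⟩⟩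
  · exact ⟨_, Or.inr ⟨⟨j, by omega⟩, by simp only []; omega, rfl⟩,
      bilin_odd ⟨j, by omega⟩ (by simp only []; omega)⟩

/-- `tensorSq` is real linear and respects commutators, so commuting with `casimir` passes from the
generators to the Lie algebra. -/
theorem commute_tensorSq_casimir {A : Op n} (hA : A ∈ dla n) (κ : ℕ) :
    Commute (tensorSq A) (casimir n κ) := by
  refine LieSubalgebra.lieSpan_induction (R := ℝ)
    (p := fun A _ => Commute (tensorSq A) (casimir n κ)) ?_ ?_ ?_ ?_ ?_ hA
  · rintro _ ⟨H, hH, rfl⟩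
    obtain ⟨k, hk, h⟩ := generator_eq_bilin hH
    rw [h]
    exact commute_tensorSq_bilin_casimir k hk κ
  · simp [tensorSq]
  · intro A B _ _ hA hB
    have : tensorSq (A + B) = tensorSq A + tensorSq B := by
      simp only [tensorSq, Matrix.add_kronecker, Matrix.kronecker_add]
      abel
    rw [this]
    exact hA.add_left hB
  · intro r A _ hA
    have : tensorSq (r • A) = r • tensorSq A := by
      simp only [tensorSq, Matrix.smul_kronecker, Matrix.kronecker_smul, smul_add]
    rw [this]
    exact hA.smul_left r
  · intro A B _ _ hA hB
    rw [LieRing.of_associative_ring_bracket, tensorSq_commutator]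
    exact (hA.mul_left hB).sub_left (hB.mul_left hA)

/-- `A ↦ A ⊗ 1` as a ring homomorphism. -/
noncomputable def kroneckerLeft (n : ℕ) :
    Op n →+* Matrix (Qubits n × Qubits n) (Qubits n × Qubits n) ℂ where
  toFun A := A ⊗ₖ (1 : Op n)
  map_one' := Matrix.one_kronecker_one
  map_mul' A B := by rw [← Matrix.mul_kronecker_mul, one_mul]
  map_zero' := Matrix.zero_kronecker _
  map_add' A B := Matrix.add_kronecker _ _ _

/-- `A ↦ 1 ⊗ A` as a ring homomorphism. -/
noncomputable def kroneckerRight (n : ℕ) :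
    Op n →+* Matrix (Qubits n × Qubits n) (Qubits n × Qubits n) ℂ where
  toFun A := (1 : Op n) ⊗ₖ A
  map_one' := Matrix.one_kronecker_one
  map_mul' A B := by rw [← Matrix.mul_kronecker_mul, one_mul]
  map_zero' := Matrix.kronecker_zero _
  map_add' A B := Matrix.kronecker_add _ _ _

theorem continuous_kronecker {X : Type*} [TopologicalSpace X] {f g : X → Op n}
    (hf : Continuous f) (hg : Continuous g) : Continuous fun x => f x ⊗ₖ g x :=
  continuous_matrix fun _ _ => (hf.matrix_elem _ _).mul (hg.matrix_elem _ _)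

theorem map_exp_matrix {R : Type*} [NormedRing R] [Algebra ℚ R] (f : Op n →+* R)
    (hf : Continuous f) (A : Op n) : f (NormedSpace.exp A) = NormedSpace.exp (f A) := by
  let _ : NormedRing (Op n) := Matrix.linftyOpNormedRing
  let _ : NormedAlgebra ℚ (Op n) := Matrix.linftyOpNormedAlgebra
  let _ : NormedAlgebra ℂ (Op n) := Matrix.linftyOpNormedAlgebra
  have hc := FiniteDimensional.complete ℂ (Op n)
  exact @NormedSpace.map_exp (Op n) R _ _ hc _ _ _ _ _ f hf A

theorem exp_kronecker_exp (A : Op n) :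
    (NormedSpace.exp A : Op n) ⊗ₖ (NormedSpace.exp A : Op n) = NormedSpace.exp (tensorSq A) := by
  let _ : NormedRing (Matrix (Qubits n × Qubits n) (Qubits n × Qubits n) ℂ) :=
    Matrix.linftyOpNormedRing
  have h1 := map_exp_matrix (kroneckerLeft n) (continuous_kronecker continuous_id continuous_const) A
  have h2 := map_exp_matrix (kroneckerRight n) (continuous_kronecker continuous_const continuous_id) A
  have hc : Commute (A ⊗ₖ (1 : Op n)) ((1 : Op n) ⊗ₖ A) := by
    rw [commute_iff_eq, ← Matrix.mul_kronecker_mul, ← Matrix.mul_kronecker_mul]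
    simp
  have h3 := Matrix.exp_add_of_commute _ _ hc
  rw [tensorSq, h3]
  change (NormedSpace.exp A : Op n) ⊗ₖ (1 : Op n) = NormedSpace.exp (A ⊗ₖ (1 : Op n)) at h1
  change (1 : Op n) ⊗ₖ (NormedSpace.exp A : Op n) = NormedSpace.exp ((1 : Op n) ⊗ₖ A) at h2
  rw [← h1, ← h2, ← Matrix.mul_kronecker_mul, one_mul, mul_one]

theorem opOf_mul (U V : matchgateGroup n) : opOf (U * V) = opOf U * opOf V := rfl

theorem opOf_conjTranspose_mul_self (U : matchgateGroup n) : (opOf U)ᴴ * opOf U = 1 :=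
  Matrix.mem_unitaryGroup_iff'.mp (U : Matrix.unitaryGroup (Qubits n) ℂ).2

/-- The condition defines a closed subgroup, so it need only be checked on exponentials, where `exp
A ⊗ exp A = exp (tensorSq A)`. -/
theorem commute_kronecker_casimir (U : matchgateGroup n) (κ : ℕ) :
    Commute (opOf U ⊗ₖ opOf U) (casimir n κ) := by
  let t : Subgroup (Matrix.unitaryGroup (Qubits n) ℂ) :=
    { carrier := {U | Commute ((U : Op n) ⊗ₖ (U : Op n)) (casimir n κ)}
      one_mem' := by simp
      mul_mem' := by
        intro U V hU hV
        have : ((U * V : Matrix.unitaryGroup (Qubits n) ℂ) : Op n) ⊗ₖ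
            ((U * V : Matrix.unitaryGroup (Qubits n) ℂ) : Op n) =
            ((U : Op n) ⊗ₖ (U : Op n)) * ((V : Op n) ⊗ₖ (V : Op n)) := by
          rw [← Matrix.mul_kronecker_mul]; rfl
        change Commute _ _
        rw [this]
        exact Commute.mul_left hU hV
      inv_mem' := by
        intro U hU
        have e1 : ((U : Op n) ⊗ₖ (U : Op n)) * (((U⁻¹ : Matrix.unitaryGroup (Qubits n) ℂ) : Op n) ⊗ₖ
            ((U⁻¹ : Matrix.unitaryGroup (Qubits n) ℂ) : Op n)) = 1 := by
          rw [← Matrix.mul_kronecker_mul, ← Submonoid.coe_mul, mul_inv_cancel]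
          simp
        have e2 : (((U⁻¹ : Matrix.unitaryGroup (Qubits n) ℂ) : Op n) ⊗ₖ
            ((U⁻¹ : Matrix.unitaryGroup (Qubits n) ℂ) : Op n)) * ((U : Op n) ⊗ₖ (U : Op n)) = 1 := by
          rw [← Matrix.mul_kronecker_mul, ← Submonoid.coe_mul, inv_mul_cancel]
          simp
        let u : (Matrix (Qubits n × Qubits n) (Qubits n × Qubits n) ℂ)ˣ := ⟨_, _, e1, e2⟩
        exact Commute.units_inv_left (u := u) hU }
  have hcl : IsClosed (t : Set (Matrix.unitaryGroup (Qubits n) ℂ)) := by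
    have h1 : Continuous fun U : Matrix.unitaryGroup (Qubits n) ℂ => (U : Op n) ⊗ₖ (U : Op n) :=
      continuous_kronecker continuous_subtype_val continuous_subtype_val
    exact isClosed_eq (h1.mul continuous_const) (continuous_const.mul h1)
  have hle : matchgateGroup n ≤ t := by
    refine Subgroup.topologicalClosure_minimal _ ((Subgroup.closure_le t).mpr ?_) hcl
    rintro U ⟨A, hA, hU⟩
    change Commute ((U : Op n) ⊗ₖ (U : Op n)) (casimir n κ)
    rw [hU, exp_kronecker_exp]
    exact ((commute_tensorSq_casimir hA κ).symm.exp_right).symm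
  exact hle U.2

/-- For Hermitian `M` the traces against `c_T` and `c_T†` are complex conjugates, so each term is a
squared modulus. -/
theorem trace_kronecker_self_mul_casimir {M : Op n} (hM : Mᴴ = M) (κ : ℕ) :
    ((M ⊗ₖ M) * casimir n κ).trace =
      ((∑ T ∈ Finset.powersetCard κ (Finset.univ : Finset (Fin (2 * n))),
        ‖(M * majoranaProd T).trace‖ ^ 2 : ℝ) : ℂ) := by
  rw [casimir, Finset.mul_sum, Matrix.trace_sum, Complex.ofReal_sum]
  refine Finset.sum_congr rfl fun T _ => ?_
  have : (M * (majoranaProd T)ᴴ).trace = star (M * majoranaProd T).trace := by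
    rw [← Matrix.trace_conjTranspose, Matrix.conjTranspose_mul, hM, Matrix.trace_mul_comm]
  rw [← Matrix.mul_kronecker_mul, Matrix.trace_kronecker, this, Complex.star_def, Complex.mul_conj,
    Complex.normSq_eq_norm_sq]

theorem sum_norm_sq_trace_conj {M : Op n} (hM : Mᴴ = M) (U : matchgateGroup n) (κ : ℕ) :
    ∑ T ∈ Finset.powersetCard κ (Finset.univ : Finset (Fin (2 * n))),
        ‖(opOf U * M * (opOf U)ᴴ * majoranaProd T).trace‖ ^ 2 =
      ∑ T ∈ Finset.powersetCard κ (Finset.univ : Finset (Fin (2 * n))),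
        ‖(M * majoranaProd T).trace‖ ^ 2 := by
  have hUM : (opOf U * M * (opOf U)ᴴ)ᴴ = opOf U * M * (opOf U)ᴴ := by
    simp only [Matrix.conjTranspose_mul, Matrix.conjTranspose_conjTranspose, hM, mul_assoc]
  have h1 := trace_kronecker_self_mul_casimir hUM κ
  rw [Matrix.mul_kronecker_mul, Matrix.mul_kronecker_mul, Matrix.trace_mul_comm, ← mul_assoc,
    ← mul_assoc, ← (commute_kronecker_casimir U κ).eq, Matrix.trace_mul_comm, ← mul_assoc,
    ← mul_assoc, ← Matrix.mul_kronecker_mul, opOf_conjTranspose_mul_self, Matrix.one_kronecker_one,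
    one_mul, Matrix.trace_mul_comm, trace_kronecker_self_mul_casimir hM κ] at h1
  exact_mod_cast h1.symm

/-! ### Rotations in `G` that swap labels or flip signs. -/

theorem exp_smul_bilin (k : ℕ) (hk : k + 1 < 2 * n) (θ : ℝ) :
    NormedSpace.exp (θ • (bilin k hk : Op n)) =
      Real.cos θ • (1 : Op n) + Real.sin θ • bilin k hk := by
  -- Since `bilin k` squares to `-1`, sending `i` to it defines a real algebra homomorphism, which
  -- carries Euler's formula over to matrices.
  let f : ℂ →ₐ[ℝ] Op n := Complex.liftAux (bilin k hk) (bilin_mul_self k hk)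
  have hf : Continuous f := by
    have : ⇑f = fun z : ℂ => z.re • (1 : Op n) + z.im • bilin k hk := by
      ext1 z
      simp [f, Complex.liftAux_apply, Algebra.algebraMap_eq_smul_one]
    rw [this]
    exact (Complex.continuous_re.smul continuous_const).add
      (Complex.continuous_im.smul continuous_const)
  have h : f (NormedSpace.exp (θ * Complex.I)) = NormedSpace.exp (f (θ * Complex.I)) := by
    let _ : NormedRing (Op n) := Matrix.linftyOpNormedRing
    exact NormedSpace.map_exp f hf (θ * Complex.I)
  rw [← Complex.exp_eq_exp_ℂ] at h
  simpa [f, Complex.liftAux_apply, Algebra.algebraMap_eq_smul_one, Complex.exp_ofReal_mul_I_re,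
    Complex.exp_ofReal_mul_I_im] using h.symm

theorem exists_opOf_eq_rotation (k : ℕ) (hk : k + 1 < 2 * n) (θ : ℝ) :
    ∃ U : matchgateGroup n, opOf U = Real.cos θ • (1 : Op n) + Real.sin θ • bilin k hk := by
  set u : Op n := Real.cos θ • (1 : Op n) + Real.sin θ • bilin k hk with hu
  have hmem : u ∈ Matrix.unitaryGroup (Qubits n) ℂ := by
    rw [Matrix.mem_unitaryGroup_iff, Matrix.star_eq_conjTranspose]
    simp only [hu, Matrix.conjTranspose_add, Matrix.conjTranspose_smul, Matrix.conjTranspose_one,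
      bilin_conjTranspose, star_trivial, mul_add, add_mul, smul_mul_smul_comm, mul_neg, one_mul,
      mul_one, bilin_mul_self, smul_neg]
    have h2 : (Real.cos θ * Real.cos θ) • (1 : Op n) + (Real.sin θ * Real.sin θ) • (1 : Op n) = 1 := by
      rw [← add_smul, ← sq, ← sq, Real.cos_sq_add_sin_sq, one_smul]
    rw [mul_comm (Real.sin θ) (Real.cos θ)]
    nth_rw 3 [← h2]
    abel
  refine ⟨⟨⟨u, hmem⟩, ?_⟩, rfl⟩
  refine Subgroup.le_topologicalClosure _ (Subgroup.subset_closure ?_)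
  exact ⟨θ • bilin k hk, (dla n).smul_mem θ (bilin_mem_dla k hk), (exp_smul_bilin k hk θ).symm⟩

/-- At angle `π/4` one has `U² = bilin k`. If `bilin k` anticommutes with `c_T`, then `U† c_T = c_T
U`, so conjugation gives `c_T * bilin k`, which is the swapped product up to sign. -/
theorem exists_conj_majoranaProd_swapSet (k : ℕ) (hk : k + 1 < 2 * n) :
    ∃ U : matchgateGroup n, ∀ T, ∃ z : ℂ, ‖z‖ = 1 ∧
      (opOf U)ᴴ * majoranaProd T * opOf U = z • majoranaProd (swapSet k hk T) := by
  obtain ⟨U, hU⟩ := exists_opOf_eq_rotation k hk (Real.pi / 4)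
  refine ⟨U, fun T => ?_⟩
  by_cases h : (⟨k, Nat.lt_of_succ_lt hk⟩ : Fin (2 * n)) ∈ T ↔ (⟨k + 1, hk⟩ : Fin (2 * n)) ∈ T
  · refine ⟨1, by simp, ?_⟩
    have hc : majoranaProd T * opOf U = opOf U * majoranaProd T := by
      rw [hU]
      simp only [mul_add, add_mul, mul_smul_comm, smul_mul_assoc, bilin_comm_majoranaProd h,
        one_mul, mul_one]
    rw [swapSet_eq_self h, mul_assoc, hc, ← mul_assoc, opOf_conjTranspose_mul_self, one_mul,
      one_smul]
  · refine ⟨-(if ⟨k, Nat.lt_of_succ_lt hk⟩ ∈ T then (-1 : ℂ) else 1), by split_ifs <;> simp, ?_⟩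
    rw [neg_smul, ← bilin_mul_majoranaProd_swap h]
    have h1 := bilin_anticomm_majoranaProd h
    have hc : (opOf U)ᴴ * majoranaProd T = majoranaProd T * opOf U := by
      rw [hU]
      simp only [Matrix.conjTranspose_add, Matrix.conjTranspose_smul, Matrix.conjTranspose_one,
        bilin_conjTranspose, star_trivial, mul_add, add_mul, mul_smul_comm, smul_mul_assoc, h1,
        one_mul, mul_one, neg_mul, smul_neg, neg_neg]
    have hs : Real.sqrt 2 / 2 * (Real.sqrt 2 / 2) = 1 / 2 := by
      have := Real.mul_self_sqrt (show (0 : ℝ) ≤ 2 by norm_num)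
      linarith
    have hsq : opOf U * opOf U = bilin k hk := by
      rw [hU, Real.cos_pi_div_four, Real.sin_pi_div_four]
      simp only [mul_add, add_mul, smul_mul_smul_comm, hs, one_mul, mul_one, bilin_mul_self]
      module
    rw [hc, mul_assoc, hsq, h1, neg_neg]

/-- At angle `π/2` the rotation is `bilin k` itself, which anticommutes with `c_T`. -/
theorem exists_conj_majoranaProd_neg {k : ℕ} {hk : k + 1 < 2 * n} {T : Finset (Fin (2 * n))}
    (h : ¬ (⟨k, Nat.lt_of_succ_lt hk⟩ ∈ T ↔ ⟨k + 1, hk⟩ ∈ T)) :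
    ∃ U : matchgateGroup n, (opOf U)ᴴ * majoranaProd T * opOf U = -majoranaProd T := by
  obtain ⟨U, hU⟩ := exists_opOf_eq_rotation k hk (Real.pi / 2)
  rw [Real.cos_pi_div_two, Real.sin_pi_div_two, zero_smul, one_smul, zero_add] at hU
  refine ⟨U, ?_⟩
  rw [hU, bilin_conjTranspose, neg_mul, bilin_anticomm_majoranaProd h, neg_neg, mul_assoc,
    bilin_mul_self, mul_neg, mul_one]

end Group

open scoped Pointwise in
/-- A function of finite sets of labels that is invariant under the exchange of neighbouring labels
depends on the cardinality only. -/
theorem eq_of_card_eq_of_map_swap {N : ℕ} {β : Type*} (F : Finset (Fin N) → β)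
    (hF : ∀ (k : ℕ) (hk : k + 1 < N) (T : Finset (Fin N)),
      F (T.map (Equiv.swap (⟨k, Nat.lt_of_succ_lt hk⟩ : Fin N) ⟨k + 1, hk⟩).toEmbedding) = F T)
    {S T : Finset (Fin N)} (h : S.card = T.card) : F S = F T := by
  cases N with
  | zero => rw [Subsingleton.elim S T]
  | succ N =>
    -- Adjacent transpositions generate the symmetric group, which acts transitively on the sets of
    -- a given size.
    have hσ : ∀ (σ : Equiv.Perm (Fin (N + 1))) (S : Finset (Fin (N + 1))), F (σ • S) = F S := by
      intro σ
      have hmem : σ ∈ Submonoid.closure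
          (Set.range fun i : Fin N => Equiv.swap i.castSucc i.succ) := by
        rw [Equiv.Perm.mclosure_swap_castSucc_succ]
        trivial
      induction hmem using Submonoid.closure_induction with
      | mem σ h =>
        obtain ⟨i, rfl⟩ := h
        intro S
        rw [← hF i.val (by omega) S]
        congr 1
        ext x
        rw [Finset.mem_map_equiv, ← Finset.inv_smul_mem_iff]
        rfl
      | one => simp
      | mul σ τ _ _ hσ hτ =>
        intro S
        rw [mul_smul, hσ, hτ]
    have := Set.powersetCard.isPretransitive (α := Fin (N + 1)) (n := T.card)
    obtain ⟨σ, hσT⟩ := MulAction.exists_smul_eq (Equiv.Perm (Fin (N + 1)))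
      (⟨S, h⟩ : Set.powersetCard (Fin (N + 1)) T.card) ⟨T, rfl⟩
    have hS : σ • S = T := congrArg Subtype.val hσT
    rw [← hS, hσ]

/-! ### First and second moments over Haar measure. -/

section Haar

variable {n : ℕ}

instance instIsHaarMeasureHaarG : Measure.IsHaarMeasure (haarG n) := by
  unfold haarG
  infer_instance

instance instIsProbabilityMeasureHaarG : IsProbabilityMeasure (haarG n) :=
  ⟨by simpa [haarG] using
    Measure.haarMeasure_self (K₀ := (⊤ : TopologicalSpace.PositiveCompacts (matchgateGroup n)))⟩

theorem continuous_opOf : Continuous (opOf : matchgateGroup n → Op n) :=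
  continuous_subtype_val.comp continuous_subtype_val

theorem memLp_comp {Ω E : Type*} [MeasurableSpace Ω] [NormedAddCommGroup E] [MeasurableSpace E]
    [BorelSpace E] [SecondCountableTopology E] {P : Measure Ω} [IsProbabilityMeasure P]
    {U : Ω → matchgateGroup n} (hU : Measurable U) {f : matchgateGroup n → E} (hf : Continuous f)
    (p : ENNReal) : MemLp (fun θ => f (U θ)) p P := by
  obtain ⟨C, hC⟩ := isCompact_univ.exists_bound_of_continuousOn hf.continuousOn
  exact MemLp.of_bound (hf.measurable.comp hU).aestronglyMeasurable C
    (ae_of_all _ fun θ => hC _ (Set.mem_univ _))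

theorem integrable_comp {Ω E : Type*} [MeasurableSpace Ω] [NormedAddCommGroup E] [MeasurableSpace E]
    [BorelSpace E] [SecondCountableTopology E] {P : Measure Ω} [IsProbabilityMeasure P]
    {U : Ω → matchgateGroup n} (hU : Measurable U) {f : matchgateGroup n → E} (hf : Continuous f) :
    Integrable (fun θ => f (U θ)) P :=
  memLp_one_iff_integrable.mp (memLp_comp hU hf 1)

/-- The design conditions are stated entry by entry; this expansion brings both moments of the loss
into that form. -/
theorem integral_re_trace_mul {Ω ι : Type*} [Fintype ι] [MeasurableSpace Ω] {P : Measure Ω}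
    [IsProbabilityMeasure P] {U : Ω → matchgateGroup n} (hU : Measurable U)
    {X : matchgateGroup n → Matrix ι ι ℂ} (hX : Continuous X) (B : Matrix ι ι ℂ) :
    ∫ θ, (X (U θ) * B).trace.re ∂P = (∑ a, ∑ b, (∫ θ, X (U θ) a b ∂P) * B b a).re := by
  have hi : ∀ a b, Integrable (fun θ => X (U θ) a b) P := fun a b =>
    integrable_comp hU (f := fun V => X V a b) (hX.matrix_elem a b)
  have ht : Integrable (fun θ => (X (U θ) * B).trace) P :=
    integrable_comp hU (f := fun V => (X V * B).trace) (hX.matrix_mul continuous_const).matrix_trace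
  have h1 : ∫ θ, (X (U θ) * B).trace.re ∂P = (∫ θ, (X (U θ) * B).trace ∂P).re :=
    integral_re ht
  rw [h1]
  congr 1
  simp only [Matrix.trace, Matrix.diag_apply, Matrix.mul_apply]
  rw [integral_finsetSum _ fun a _ => integrable_finsetSum _ fun b _ => (hi a b).mul_const _]
  refine Finset.sum_congr rfl fun a _ => ?_
  rw [integral_finsetSum _ fun b _ => (hi a b).mul_const _]
  exact Finset.sum_congr rfl fun b _ => integral_mul_const _ _

theorem continuous_conj (ρ : Op n) :
    Continuous fun U : matchgateGroup n => opOf U * ρ * (opOf U)ᴴ :=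
  (continuous_opOf.matrix_mul continuous_const).matrix_mul continuous_opOf.matrix_conjTranspose

theorem continuous_loss (ρ O : Op n) : Continuous (loss ρ O) :=
  Complex.continuous_re.comp ((continuous_conj ρ).matrix_mul continuous_const).matrix_trace

theorem ofReal_loss {ρ O : Op n} (hρ : ρᴴ = ρ) (hO : Oᴴ = O) (U : matchgateGroup n) :
    (loss ρ O U : ℂ) = (opOf U * ρ * (opOf U)ᴴ * O).trace := by
  rw [loss, ← Complex.conj_eq_iff_re, ← Complex.star_def, ← Matrix.trace_conjTranspose]
  simp only [Matrix.conjTranspose_mul, Matrix.conjTranspose_conjTranspose, hρ, hO]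
  rw [Matrix.trace_mul_comm]
  simp only [mul_assoc]

/-- A square of a trace is a trace over two copies, where the condition for `t = 2` applies.
Hermiticity makes the trace real, so that taking the real part before squaring loses nothing. -/
theorem loss_sq {ρ O : Op n} (hρ : ρᴴ = ρ) (hO : Oᴴ = O) (U : matchgateGroup n) :
    loss ρ O U ^ 2 = (((opOf U ⊗ₖ opOf U) * (ρ ⊗ₖ ρ) * (opOf U ⊗ₖ opOf U)ᴴ) * (O ⊗ₖ O)).trace.re := by
  rw [Matrix.conjTranspose_kronecker]
  simp only [← Matrix.mul_kronecker_mul]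
  rw [Matrix.trace_kronecker, ← ofReal_loss hρ hO, ← Complex.ofReal_mul, Complex.ofReal_re, sq]

theorem MatchgateEnsemble.integral_loss (E : MatchgateEnsemble n) (ρ O : Op n) :
    ∫ θ, loss ρ O (E.U θ) ∂E.prob = ∫ V, loss ρ O V ∂haarG n := by
  have := E.isProb
  have h1 := integral_re_trace_mul (P := E.prob) E.measurable_U (continuous_conj ρ) O
  have h2 := integral_re_trace_mul (P := haarG n) measurable_id (continuous_conj ρ) O
  simp only [E.design_one] at h1
  exact h1.trans h2.symm

theorem MatchgateEnsemble.integral_loss_sq (E : MatchgateEnsemble n) {ρ O : Op n}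
    (hρ : ρᴴ = ρ) (hO : Oᴴ = O) :
    ∫ θ, loss ρ O (E.U θ) ^ 2 ∂E.prob = ∫ V, loss ρ O V ^ 2 ∂haarG n := by
  have := E.isProb
  have hX : Continuous fun U : matchgateGroup n =>
      (opOf U ⊗ₖ opOf U) * (ρ ⊗ₖ ρ) * (opOf U ⊗ₖ opOf U)ᴴ := by
    have h := continuous_kronecker (n := n) continuous_opOf continuous_opOf
    exact (h.matrix_mul continuous_const).matrix_mul h.matrix_conjTranspose
  simp only [loss_sq hρ hO]
  have h1 := integral_re_trace_mul (P := E.prob) E.measurable_U hX (O ⊗ₖ O)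
  have h2 := integral_re_trace_mul (P := haarG n) measurable_id hX (O ⊗ₖ O)
  simp only [E.design_two] at h1
  exact h1.trans h2.symm

theorem MatchgateEnsemble.lossVariance_eq (E : MatchgateEnsemble n) {ρ O : Op n}
    (hρ : ρᴴ = ρ) (hO : Oᴴ = O) :
    E.lossVariance ρ O =
      ∫ V, loss ρ O V ^ 2 ∂haarG n - (∫ V, loss ρ O V ∂haarG n) ^ 2 := by
  have := E.isProb
  rw [lossVariance, variance_eq_sub (memLp_comp E.measurable_U (continuous_loss ρ O) 2),
    ← E.integral_loss ρ O, ← E.integral_loss_sq hρ hO]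
  rfl

theorem trace_conj_mul_left (V U : matchgateGroup n) (ρ S : Op n) :
    (opOf (V * U) * ρ * (opOf (V * U))ᴴ * S).trace =
      (opOf U * ρ * (opOf U)ᴴ * ((opOf V)ᴴ * S * opOf V)).trace := by
  rw [opOf_mul, Matrix.conjTranspose_mul]
  simp only [mul_assoc]
  rw [Matrix.trace_mul_comm]
  simp only [mul_assoc]

theorem loss_mul_left (V U : matchgateGroup n) (ρ S : Op n) :
    loss ρ S (V * U) = loss ρ ((opOf V)ᴴ * S * opOf V) U := by
  rw [loss, loss, trace_conj_mul_left]

/-- A swap of neighbouring labels is a left translation by an element of `G`, up to a phase that the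
modulus removes. -/
theorem integral_norm_sq_trace_eq (ρ : Op n) {S T : Finset (Fin (2 * n))} (h : S.card = T.card) :
    ∫ U, ‖(opOf U * ρ * (opOf U)ᴴ * majoranaProd S).trace‖ ^ 2 ∂haarG n =
      ∫ U, ‖(opOf U * ρ * (opOf U)ᴴ * majoranaProd T).trace‖ ^ 2 ∂haarG n := by
  refine eq_of_card_eq_of_map_swap (fun T : Finset (Fin (2 * n)) =>
    ∫ U, ‖(opOf U * ρ * (opOf U)ᴴ * majoranaProd T).trace‖ ^ 2 ∂haarG n) (fun k hk T => ?_) h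
  obtain ⟨W, hW⟩ := exists_conj_majoranaProd_swapSet (n := n) k hk
  obtain ⟨z, hz, hWT⟩ := hW T
  rw [← integral_mul_left_eq_self (μ := haarG n)
    (fun U => ‖(opOf U * ρ * (opOf U)ᴴ * majoranaProd T).trace‖ ^ 2) W]
  simp only [trace_conj_mul_left, hWT, mul_smul_comm, Matrix.trace_smul, norm_smul, hz, one_mul]
  rfl

theorem IsPureGaussian.conjTranspose {ρ : Op n} (h : IsPureGaussian ρ) : ρᴴ = ρ := by
  obtain ⟨U, rfl | ⟨_, rfl⟩⟩ := h <;> exact ketbra_conjTranspose _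

theorem IsPureGaussian.sum_norm_sq_trace {ρ : Op n} (h : IsPureGaussian ρ) {κ : ℕ}
    (hκ : Even κ) :
    ∑ T ∈ Finset.powersetCard κ (Finset.univ : Finset (Fin (2 * n))),
      ‖(ρ * majoranaProd T).trace‖ ^ 2 = n.choose (κ / 2) := by
  obtain ⟨U, rfl | ⟨_, rfl⟩⟩ := h
  · rw [ketbra_mulVec, sum_norm_sq_trace_conj (ketbra_conjTranspose _)]
    exact sum_norm_sq_trace_of_norm_eq hκ fun T => rfl
  · rw [ketbra_mulVec, sum_norm_sq_trace_conj (ketbra_conjTranspose _)]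
    exact sum_norm_sq_trace_of_norm_eq hκ fun T => norm_trace_ketbra_majorana_mul _ T

/-- All `C(2n, κ)` moments are equal, and their sum is the integral of a constant function. -/
theorem IsPureGaussian.integral_norm_sq_trace {ρ : Op n} (h : IsPureGaussian ρ) {κ : ℕ}
    (hκ : Even κ) (hκn : κ < 2 * n) {T : Finset (Fin (2 * n))} (hT : T.card = κ) :
    ∫ U, ‖(opOf U * ρ * (opOf U)ᴴ * majoranaProd T).trace‖ ^ 2 ∂haarG n =
      (n.choose (κ / 2) : ℝ) / ((2 * n).choose κ : ℝ) := by
  have hc : ((2 * n).choose κ : ℝ) ≠ 0 := by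
    exact_mod_cast (Nat.choose_pos hκn.le).ne'
  have hi : ∀ S : Finset (Fin (2 * n)), Integrable
      (fun U => ‖(opOf U * ρ * (opOf U)ᴴ * majoranaProd S).trace‖ ^ 2) (haarG n) := fun S =>
    integrable_comp measurable_id
      ((((continuous_conj ρ).matrix_mul continuous_const).matrix_trace.norm).pow 2)
  have h1 : ∫ U, ∑ S ∈ Finset.powersetCard κ (Finset.univ : Finset (Fin (2 * n))),
      ‖(opOf U * ρ * (opOf U)ᴴ * majoranaProd S).trace‖ ^ 2 ∂haarG n = n.choose (κ / 2) := by
    simp only [sum_norm_sq_trace_conj h.conjTranspose, h.sum_norm_sq_trace hκ]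
    simp
  rw [integral_finsetSum _ fun S _ => hi S, Finset.sum_congr rfl fun S hS =>
    integral_norm_sq_trace_eq ρ (((Finset.mem_powersetCard.mp hS).2).trans hT.symm),
    Finset.sum_const, Finset.card_powersetCard, Finset.card_univ, Fintype.card_fin,
    nsmul_eq_mul] at h1
  rw [eq_div_iff hc, mul_comm]
  exact h1

/-- If membership never changed between neighbours, `T` would be empty or everything. The pair found
here provides the sign flip that kills the mean. -/
theorem exists_consecutive_not_iff {N : ℕ} {T : Finset (Fin N)} (h0 : 0 < T.card)
    (h1 : T.card < N) :
    ∃ (k : ℕ) (hk : k + 1 < N), ¬ ((⟨k, Nat.lt_of_succ_lt hk⟩ : Fin N) ∈ T ↔ ⟨k + 1, hk⟩ ∈ T) := by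
  by_contra! hc
  have hall : ∀ (k : ℕ) (hk : k < N), (⟨k, hk⟩ : Fin N) ∈ T ↔ ⟨0, by omega⟩ ∈ T := by
    intro k
    induction k with
    | zero => intro _; rfl
    | succ k ih => intro hk; rw [← hc k hk, ih]
  obtain ⟨x, hx⟩ := Finset.card_pos.mp h0
  have huniv : T = Finset.univ :=
    Finset.eq_univ_of_forall fun y => (hall y.val y.2).mpr ((hall x.val x.2).mp hx)
  rw [huniv, Finset.card_univ, Fintype.card_fin] at h1
  exact h1.false

theorem integral_loss_smul_majoranaProd (ρ : Op n) (z : ℂ) {T : Finset (Fin (2 * n))}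
    (h0 : 0 < T.card) (h1 : T.card < 2 * n) :
    ∫ U, loss ρ (z • majoranaProd T) U ∂haarG n = 0 := by
  obtain ⟨k, hk, h⟩ := exists_consecutive_not_iff h0 h1
  obtain ⟨W, hW⟩ := exists_conj_majoranaProd_neg (n := n) h
  have h2 := integral_mul_left_eq_self (μ := haarG n) (loss ρ (z • majoranaProd T)) W
  have h3 : ∀ U, loss ρ (z • majoranaProd T) (W * U) = -loss ρ (z • majoranaProd T) U := by
    intro U
    rw [loss_mul_left, mul_smul_comm, smul_mul_assoc, hW, loss, loss, smul_neg, mul_neg,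
      Matrix.trace_neg, Complex.neg_re]
  simp only [h3, integral_neg] at h2
  exact neg_eq_self.mp h2

theorem MatchgateEnsemble.lossVariance_eq_div (E : MatchgateEnsemble n) {κ : ℕ} {ρ O : Op n}
    (hκ : Even κ) (hκ0 : 0 < κ) (hκn : κ < 2 * n) (hρ : IsPureGaussian ρ)
    (hO : IsModulePauli κ O) :
    E.lossVariance ρ O = (n.choose (κ / 2) : ℝ) / ((2 * n).choose κ : ℝ) := by
  obtain ⟨S, V, hS, hSm, rfl⟩ := hO
  have hSh := hS.conjTranspose
  obtain ⟨T, z, hT, hz, hST⟩ := hS.eq_smul_majoranaProd hSm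
  have hOh : ((opOf V)ᴴ * S * opOf V)ᴴ = (opOf V)ᴴ * S * opOf V := by
    simp only [Matrix.conjTranspose_mul, Matrix.conjTranspose_conjTranspose, hSh, mul_assoc]
  rw [E.lossVariance_eq hρ.conjTranspose hOh]
  -- The conjugation by `V` becomes a left translation of the integration variable.
  simp only [← loss_mul_left]
  rw [integral_mul_left_eq_self (μ := haarG n) (loss ρ S) V,
    integral_mul_left_eq_self (μ := haarG n) (fun U => loss ρ S U ^ 2) V]
  have hsq : ∀ U, loss ρ S U ^ 2 =
      ‖(opOf U * ρ * (opOf U)ᴴ * majoranaProd T).trace‖ ^ 2 := by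
    intro U
    have := congrArg (‖·‖ ^ 2) (ofReal_loss hρ.conjTranspose hSh U)
    simp only [Complex.norm_real, Real.norm_eq_abs, sq_abs] at this
    rw [this, hST, mul_smul_comm, Matrix.trace_smul, norm_smul, hz, one_mul]
  simp only [hsq]
  rw [hρ.integral_norm_sq_trace hκ hκn hT, hST,
    integral_loss_smul_majoranaProd ρ z (by omega) (by omega)]
  simp

end Haar

/-! ### Monotonicity and bounds for the binomial ratio. -/

section Ratio

/-- The ratio `C(n, m) / C(2n, 2m)`. -/
noncomputable def chooseRatio (n m : ℕ) : ℝ := (n.choose m : ℝ) / ((2 * n).choose (2 * m) : ℝ)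

theorem chooseRatio_zero (n : ℕ) : chooseRatio n 0 = 1 := by simp [chooseRatio]

theorem chooseRatio_pos {n m : ℕ} (h : m ≤ n) : 0 < chooseRatio n m := by
  have h1 : 0 < n.choose m := Nat.choose_pos h
  have h2 : 0 < (2 * n).choose (2 * m) := Nat.choose_pos (by omega)
  unfold chooseRatio
  positivity

theorem chooseRatio_symm {n m : ℕ} (h : m ≤ n) : chooseRatio n (n - m) = chooseRatio n m := by
  unfold chooseRatio
  rw [Nat.mul_sub, Nat.choose_symm h, Nat.choose_symm (by omega)]

/-- The numerator gains `(n-m)/(m+1)`, the denominator `(2n-2m)(2n-2m-1)/((2m+1)(2m+2))`, and the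
common factors cancel. -/
theorem chooseRatio_succ {n m : ℕ} (h : m < n) :
    chooseRatio n (m + 1) = chooseRatio n m * ((2 * m + 1) / (2 * n - 2 * m - 1)) := by
  have h1 := Nat.choose_succ_right_eq n m
  have h2 := Nat.choose_succ_right_eq (2 * n) (2 * m)
  have h3 := Nat.choose_succ_right_eq (2 * n) (2 * m + 1)
  have p1 : 0 < (2 * n).choose (2 * m) := Nat.choose_pos (by omega)
  have p2 : 0 < (2 * n).choose (2 * m + 2) := Nat.choose_pos (by omega)
  have hR : (m : ℝ) + 1 ≤ n := by exact_mod_cast h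
  have h1' := congrArg (Nat.cast (R := ℝ)) h1
  have h2' := congrArg (Nat.cast (R := ℝ)) h2
  have h3' := congrArg (Nat.cast (R := ℝ)) h3
  rw [Nat.cast_mul, Nat.cast_mul, Nat.cast_sub h.le] at h1'
  rw [Nat.cast_mul, Nat.cast_mul, Nat.cast_sub (by omega)] at h2' h3'
  push_cast at h1' h2' h3'
  have p1' : (0 : ℝ) < (2 * n).choose (2 * m) := by exact_mod_cast p1
  have p2' : (0 : ℝ) < (2 * n).choose (2 * m + 2) := by exact_mod_cast p2
  have p3 : (0 : ℝ) < 2 * n - 2 * m - 1 := by linarith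
  have e : ((2 * n).choose (2 * m + 2) : ℝ) * ((2 * m + 2) * (2 * m + 1)) =
      (2 * n).choose (2 * m) * ((2 * n - 2 * m) * (2 * n - 2 * m - 1)) := by
    linear_combination (2 * m + 1 : ℝ) * h3' + (2 * n - (2 * m + 1) : ℝ) * h2'
  unfold chooseRatio
  rw [show 2 * (m + 1) = 2 * m + 2 by ring, ← mul_div_mul_comm, div_eq_div_iff p2'.ne' (by positivity)]
  have hm : (2 * m + 2 : ℝ) ≠ 0 := by positivity
  apply mul_right_cancel₀ hm
  linear_combination (2 * (2 * n).choose (2 * m) * (2 * n - 2 * m - 1) : ℝ) * h1' -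
    (n.choose m : ℝ) * e

theorem chooseRatio_lt_of_lt {n m k : ℕ} (h : m < k) (hk : 2 * k ≤ n) :
    chooseRatio n k < chooseRatio n m := by
  induction k, h using Nat.le_induction with
  | base =>
    have hR : 2 * ((m : ℝ) + 1) ≤ n := by exact_mod_cast hk
    rw [Nat.succ_eq_add_one, chooseRatio_succ (by omega)]
    refine mul_lt_of_lt_one_right (chooseRatio_pos (by omega)) ?_
    rw [div_lt_one (by linarith)]
    linarith
  | succ k hmk ih =>
    have hmk' : m < k := hmk
    refine lt_of_le_of_lt ?_ (ih (by omega))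
    have hR : 2 * ((k : ℝ) + 1) ≤ n := by exact_mod_cast hk
    rw [chooseRatio_succ (by omega)]
    refine mul_le_of_le_one_right (chooseRatio_pos (by omega)).le ?_
    rw [div_le_one (by linarith)]
    linarith

theorem chooseRatio_le_of_le {n m k : ℕ} (h : m ≤ k) (hk : 2 * k ≤ n) :
    chooseRatio n k ≤ chooseRatio n m := by
  rcases h.eq_or_lt with rfl | h
  · exact le_rfl
  · exact (chooseRatio_lt_of_lt h hk).le

/-- Each factor `(2j+1)/(2n-2j-1)` is at least `(j+1)/(2n)`. -/
theorem factorial_div_le_chooseRatio {n m : ℕ} (h : m ≤ n) :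
    (m.factorial : ℝ) / (2 * n) ^ m ≤ chooseRatio n m := by
  induction m with
  | zero => simp [chooseRatio_zero]
  | succ m ih =>
    have hR : (m : ℝ) + 1 ≤ n := by exact_mod_cast h
    have hm : (0 : ℝ) ≤ m := m.cast_nonneg
    rw [chooseRatio_succ (by omega), Nat.factorial_succ, pow_succ, Nat.cast_mul, mul_comm (Nat.cast _),
      mul_div_mul_comm]
    refine mul_le_mul (ih (by omega)) ?_ (by positivity) (chooseRatio_pos (by omega)).le
    push_cast
    exact div_le_div₀ (by linarith) (by linarith) (by linarith) (by linarith)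

theorem one_div_pow_le_chooseRatio {n m M : ℕ} (h : m ≤ n) (hn : 0 < n) (hM : m ≤ M) :
    1 / (2 * (n : ℝ)) ^ M ≤ chooseRatio n m := by
  have hn' : (1 : ℝ) ≤ n := by exact_mod_cast hn
  refine le_trans ?_ (factorial_div_le_chooseRatio h)
  have h1 : (1 : ℝ) ≤ m.factorial := by exact_mod_cast m.factorial_pos
  exact div_le_div₀ (by positivity) h1 (by positivity)
    (pow_le_pow_right₀ (by linarith) hM)

theorem chooseRatio_le_pow {n k : ℕ} (hk : 2 * k ≤ n) :
    chooseRatio n k ≤ (2 * (k : ℝ) / n) ^ k := by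
  -- The base stays fixed while the exponent grows: for `j < k ≤ n/2` the factor `(2j+1)/(2n-2j-1)`
  -- has numerator at most `2k` and denominator at least `n`.
  suffices h : ∀ m ≤ k, chooseRatio n m ≤ (2 * (k : ℝ) / n) ^ m from h k le_rfl
  intro m
  induction m with
  | zero => simp [chooseRatio_zero]
  | succ m ih =>
    intro hm
    have hR : (m : ℝ) + 1 ≤ k := by exact_mod_cast hm
    have hkR : 2 * (k : ℝ) ≤ n := by exact_mod_cast hk
    have hm0 : (0 : ℝ) ≤ m := m.cast_nonneg
    rw [chooseRatio_succ (by omega), pow_succ]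
    refine mul_le_mul (ih (by omega)) ?_ (div_nonneg (by linarith) (by linarith)) (by positivity)
    exact div_le_div₀ (by linarith) (by linarith) (by linarith) (by linarith)

/-- The factors approach one as `m` nears `n/2`, but the first `⌊m/2⌋` of them are at most `1/2`;
monotonicity discards the rest. -/
theorem chooseRatio_le_half_pow {n m : ℕ} (h : 2 * m ≤ n) :
    chooseRatio n m ≤ (1 / 2 : ℝ) ^ (m / 2) := by
  refine (chooseRatio_le_of_le (Nat.div_le_self m 2) h).trans ?_
  have h4 : 4 * (m / 2) ≤ n := by omega
  generalize m / 2 = k at h4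
  induction k with
  | zero => simp [chooseRatio_zero]
  | succ k ih =>
    have hR : 4 * ((k : ℝ) + 1) ≤ n := by exact_mod_cast h4
    have hk0 : (0 : ℝ) ≤ k := k.cast_nonneg
    rw [chooseRatio_succ (by omega), pow_succ]
    refine mul_le_mul (ih (by omega)) ?_ (div_nonneg (by linarith) (by linarith)) (by positivity)
    rw [div_le_iff₀ (by linarith)]
    linarith

/-- This combines `m!/(2n)^m` with `(2nδ)^m/m! ≤ exp(2nδ)`. The parameter `δ` is free: a small value
makes the loss linear in `n` as slow as desired. -/
theorem exp_neg_le_chooseRatio {n m : ℕ} (h : m ≤ n) (hn : 0 < n) {δ : ℝ} (hδ : 0 < δ) :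
    Real.exp (m * Real.log δ - 2 * n * δ) ≤ chooseRatio n m := by
  have hn' : (0 : ℝ) < n := by exact_mod_cast hn
  refine le_trans ?_ (factorial_div_le_chooseRatio h)
  have h1 := Real.pow_div_factorial_le_exp (2 * n * δ) (by positivity) m
  have h2 : (0 : ℝ) < m.factorial := by exact_mod_cast m.factorial_pos
  rw [div_le_iff₀ h2] at h1
  rw [Real.exp_sub, mul_comm (m : ℝ), ← Real.rpow_def_of_pos hδ, Real.rpow_natCast,
    div_le_div_iff₀ (Real.exp_pos _) (by positivity), ← mul_pow, mul_comm δ]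
  linarith

end Ratio

/-! ### Asymptotic regimes in terms of half the globality. -/

section Scaling

variable {v : ℕ → ℝ} {m : ℕ → ℕ}

theorem hasBarrenPlateau_iff (hv : ∀ᶠ n in atTop, v n = chooseRatio n (m n) ∧ 2 * m n ≤ n) :
    HasBarrenPlateau v ↔
      ∃ c : ℝ, 0 < c ∧ ∀ᶠ n : ℕ in atTop, c * (n : ℝ) ≤ ((2 * m n : ℕ) : ℝ) := by
  constructor
  · rintro ⟨b, hb, hO⟩
    obtain ⟨C, hC, hO⟩ := hO.exists_pos
    have hL : 0 < Real.log b := Real.log_pos hb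
    -- With `δ ≤ log b / 4` the term `2nδ` costs at most half of the decay `n log b`, and another
    -- quarter absorbs `log C` for large `n`; the last quarter bounds `m` from below. The cap `1/2`
    -- makes `log δ` negative.
    set δ : ℝ := min (1 / 2) (Real.log b / 4) with hδ
    have hδ0 : 0 < δ := by positivity
    have hδ1 : δ ≤ 1 / 2 := min_le_left _ _
    have hδ2 : δ ≤ Real.log b / 4 := min_le_right _ _
    have hK : Real.log δ < 0 := Real.log_neg hδ0 (by linarith)
    refine ⟨Real.log b / (2 * -Real.log δ), div_pos hL (by linarith), ?_⟩
    have hlarge : ∀ᶠ n : ℕ in atTop, 4 * Real.log C / Real.log b ≤ n :=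
      tendsto_natCast_atTop_atTop.eventually_ge_atTop _
    filter_upwards [hO.bound, hv, eventually_gt_atTop 0, hlarge] with n hn ⟨hvn, hm⟩ hn0 hnC
    have hb0 : 0 < b := by linarith
    have h1 := exp_neg_le_chooseRatio (show m n ≤ n by omega) hn0 hδ0
    rw [hvn, Real.norm_of_nonneg (chooseRatio_pos (by omega)).le,
      Real.norm_of_nonneg (by positivity)] at hn
    have h2 : C * (1 / b ^ n) = Real.exp (Real.log C - n * Real.log b) := by
      rw [Real.exp_sub, Real.exp_log hC, ← Real.log_pow, Real.exp_log (by positivity)]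
      ring
    have h3 := Real.exp_le_exp.mp ((h1.trans hn).trans_eq h2)
    rw [div_le_iff₀ hL] at hnC
    have h4 : (n : ℝ) * δ ≤ n * (Real.log b / 4) := mul_le_mul_of_nonneg_left hδ2 n.cast_nonneg
    rw [div_mul_eq_mul_div, div_le_iff₀ (by linarith)]
    push_cast
    nlinarith
  · rintro ⟨c, hc, hg⟩
    have hl2 : 0 < Real.log 2 := Real.log_pos (by norm_num)
    -- The base is `2^(c/4)`, because `⌊m/2⌋ ≥ cn/4 - 1`; the constant `2` pays for the rounding.
    refine ⟨Real.exp (Real.log 2 * (c / 4)), Real.one_lt_exp_iff.mpr (by positivity),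
      IsBigO.of_bound 2 ?_⟩
    filter_upwards [hg, hv] with n hgn ⟨hvn, hm⟩
    rw [hvn, Real.norm_of_nonneg (chooseRatio_pos (by omega)).le,
      Real.norm_of_nonneg (by positivity)]
    refine (chooseRatio_le_half_pow hm).trans ?_
    have hk : c * n ≤ 4 * ((m n / 2 : ℕ) : ℝ) + 4 := by
      refine hgn.trans ?_
      have : 2 * m n ≤ 4 * (m n / 2) + 4 := by omega
      exact_mod_cast this
    have e1 : (1 / 2 : ℝ) ^ (m n / 2) = Real.exp (-(((m n / 2 : ℕ) : ℝ) * Real.log 2)) := by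
      rw [Real.exp_neg, ← Real.log_pow, Real.exp_log (by positivity), one_div, inv_pow]
    have e2 : 2 * (1 / Real.exp (Real.log 2 * (c / 4)) ^ n) =
        Real.exp (Real.log 2 - n * (Real.log 2 * (c / 4))) := by
      rw [Real.exp_sub, Real.exp_log (by norm_num), Real.exp_nat_mul]
      ring
    rw [e1, e2]
    refine Real.exp_le_exp.mpr ?_
    nlinarith [mul_le_mul_of_nonneg_left hk hl2.le]

/-- Monotonicity replaces `m n` by `p`, so the constant depends on `p` alone. -/
theorem exists_eventually_le_div_pow
    (hv : ∀ᶠ n in atTop, v n = chooseRatio n (m n) ∧ 2 * m n ≤ n) (p : ℕ) :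
    ∃ K : ℝ, ∀ᶠ n : ℕ in atTop, p ≤ m n → v n ≤ K / (n : ℝ) ^ p := by
  refine ⟨(2 * p : ℝ) ^ p, ?_⟩
  filter_upwards [hv] with n ⟨hvn, hm⟩ hp
  rw [hvn, ← div_pow]
  exact (chooseRatio_le_of_le hp hm).trans (chooseRatio_le_pow (by omega))

theorem eventually_one_div_pow_le
    (hv : ∀ᶠ n in atTop, v n = chooseRatio n (m n) ∧ 2 * m n ≤ n) (p : ℕ) :
    ∀ᶠ n : ℕ in atTop, m n ≤ p → (1 / 2 ^ p) * (1 / (n : ℝ) ^ p) ≤ v n := by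
  filter_upwards [hv, eventually_gt_atTop 0] with n ⟨hvn, hm⟩ hn hp
  rw [hvn, one_div_mul_one_div, ← mul_pow]
  exact one_div_pow_le_chooseRatio (by omega) hn hp

theorem eventually_scaled_pos
    (hv : ∀ᶠ n in atTop, v n = chooseRatio n (m n) ∧ 2 * m n ≤ n) :
    ∀ᶠ n : ℕ in atTop, 0 < v n := by
  filter_upwards [hv] with n ⟨hvn, hm⟩
  rw [hvn]
  exact chooseRatio_pos (by omega)

theorem superpolynomialDecay_iff
    (hv : ∀ᶠ n in atTop, v n = chooseRatio n (m n) ∧ 2 * m n ≤ n) :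
    SuperpolynomialDecay atTop (fun n : ℕ => (n : ℝ)) v ↔ Tendsto m atTop atTop := by
  constructor
  · intro h
    rw [tendsto_atTop]
    intro p
    have h1 : ∀ᶠ n : ℕ in atTop, (n : ℝ) ^ p * v n < 1 / 2 ^ p :=
      (h p).eventually_lt_const (by positivity)
    filter_upwards [h1, eventually_one_div_pow_le hv p, eventually_gt_atTop 0] with n hn hlow hn0
    by_contra! hlt
    have hpos : (0 : ℝ) < (n : ℝ) ^ p := by positivity
    have h2 := mul_le_mul_of_nonneg_left (hlow hlt.le) hpos.le
    have h3 : (n : ℝ) ^ p * (1 / 2 ^ p * (1 / (n : ℝ) ^ p)) = 1 / 2 ^ p := by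
      field_simp
    linarith
  · intro h p
    -- The extra power of `n` makes the product with `n ^ p` tend to zero instead of merely staying
    -- bounded.
    obtain ⟨K, hK⟩ := exists_eventually_le_div_pow hv (p + 1)
    have hlim : Tendsto (fun n : ℕ => K / (n : ℝ)) atTop (𝓝 0) :=
      tendsto_const_div_atTop_nhds_zero_nat K
    refine squeeze_zero' ?_ ?_ hlim
    · filter_upwards [eventually_scaled_pos hv] with n hn
      positivity
    · filter_upwards [hK, h.eventually_ge_atTop (p + 1), eventually_gt_atTop 0] with n hn hp hn0
      have hpos : (0 : ℝ) < (n : ℝ) ^ p := by positivity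
      refine (mul_le_mul_of_nonneg_left (hn hp) hpos.le).trans_eq ?_
      rw [pow_succ]
      field_simp

theorem one_div_pow_isBigO_iff
    (hv : ∀ᶠ n in atTop, v n = chooseRatio n (m n) ∧ 2 * m n ≤ n) :
    (∃ p : ℕ, (fun n : ℕ => 1 / (n : ℝ) ^ p) =O[atTop] v) ↔
      ∃ T : ℕ, ∀ᶠ n : ℕ in atTop, m n ≤ T := by
  constructor
  · rintro ⟨p, hp⟩
    obtain ⟨C, hC, hp⟩ := hp.exists_pos
    obtain ⟨K, hK⟩ := exists_eventually_le_div_pow hv (p + 1)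
    -- Wherever `m n > p`, the variance is at most `K / n^(p+1)`, which contradicts the lower bound
    -- once `n > C K`.
    refine ⟨p, ?_⟩
    have hlarge : ∀ᶠ n : ℕ in atTop, C * K < n :=
      tendsto_natCast_atTop_atTop.eventually_gt_atTop _
    filter_upwards [hp.bound, hK, eventually_scaled_pos hv, hlarge, eventually_gt_atTop 0]
      with n hn hKn hpos hnC hn0
    by_contra! hlt
    have hn0' : (0 : ℝ) < n := by exact_mod_cast hn0
    rw [Real.norm_of_nonneg (by positivity), Real.norm_of_nonneg hpos.le] at hn
    have h1 := hn.trans (mul_le_mul_of_nonneg_left (hKn hlt) hC.le)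
    rw [pow_succ, ← mul_div_assoc, div_le_div_iff₀ (by positivity) (by positivity), one_mul,
      mul_comm] at h1
    exact absurd (le_of_mul_le_mul_right h1 (by positivity)) (by linarith)
  · rintro ⟨T, hT⟩
    refine ⟨T, IsBigO.of_bound (2 ^ T) ?_⟩
    filter_upwards [hT, eventually_one_div_pow_le hv T, eventually_scaled_pos hv] with n hn hlow hpos
    have h1 := hlow hn
    rw [Real.norm_of_nonneg (by positivity), Real.norm_of_nonneg hpos.le]
    rwa [one_div_mul_eq_div, div_le_iff₀' (by positivity)] at h1

theorem isTheta_of_eventually_eq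
    (hv : ∀ᶠ n in atTop, v n = chooseRatio n (m n) ∧ 2 * m n ≤ n) {M : ℕ}
    (hM : ∀ᶠ n in atTop, m n = M) : v =Θ[atTop] fun n : ℕ => 1 / (n : ℝ) ^ M := by
  constructor
  · obtain ⟨K, hK⟩ := exists_eventually_le_div_pow hv M
    refine IsBigO.of_bound K ?_
    filter_upwards [hK, hM, eventually_scaled_pos hv] with n hn hmn hpos
    rw [Real.norm_of_nonneg hpos.le, Real.norm_of_nonneg (by positivity), mul_one_div]
    exact hn hmn.ge
  · refine IsBigO.of_bound (2 ^ M) ?_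
    filter_upwards [hM, eventually_one_div_pow_le hv M, eventually_scaled_pos hv]
      with n hn hlow hpos
    have h1 := hlow hn.le
    rw [Real.norm_of_nonneg (by positivity), Real.norm_of_nonneg hpos.le]
    rwa [one_div_mul_eq_div, div_le_iff₀' (by positivity)] at h1

theorem not_hasBarrenPlateau_of_eventually_eq
    (hv : ∀ᶠ n in atTop, v n = chooseRatio n (m n) ∧ 2 * m n ≤ n) {M : ℕ}
    (hM : ∀ᶠ n in atTop, m n = M) : ¬ HasBarrenPlateau v := by
  rw [hasBarrenPlateau_iff hv]
  rintro ⟨c, hc, h⟩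
  have hlarge : ∀ᶠ n : ℕ in atTop, ((2 * M : ℕ) : ℝ) / c < n :=
    tendsto_natCast_atTop_atTop.eventually_gt_atTop _
  obtain ⟨n, h1, h2, h3⟩ := (h.and (hM.and hlarge)).exists
  rw [h2] at h1
  rw [div_lt_iff₀ hc] at h3
  linarith

end Scaling

/-! ### The variance as a function of the globality, and the theorem. -/

theorem MatchgateEnsemble.lossVariance_eq_chooseRatio {n κ : ℕ} (E : MatchgateEnsemble n)
    {ρ O : Op n} (hκ : Even κ) (hκ0 : 0 < κ) (hκn : κ < 2 * n) (hρ : IsPureGaussian ρ)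
    (hO : IsModulePauli κ O) :
    E.lossVariance ρ O = chooseRatio n (globality n κ / 2) ∧
      globality n κ = 2 * (globality n κ / 2) ∧ 2 * (globality n κ / 2) ≤ n := by
  rw [E.lossVariance_eq_div hκ hκ0 hκn hρ hO]
  obtain ⟨a, rfl⟩ := hκ
  unfold globality
  refine ⟨?_, by omega, by omega⟩
  have e : ((n.choose ((a + a) / 2) : ℝ) / ((2 * n).choose (a + a) : ℝ)) = chooseRatio n a := by
    rw [chooseRatio, ← two_mul, Nat.mul_div_cancel_left a two_pos]
  rw [e]
  -- Half the globality is `a` or `n - a`, and the ratio is the same at both.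
  rcases le_total (a + a) (2 * n - (a + a)) with h | h
  · rw [min_eq_left h]
    congr 1
    omega
  · rw [min_eq_right h, ← chooseRatio_symm (show a ≤ n by omega)]
    congr 1
    omega

theorem mainTheorem11 :
    -- exact variance
    (∀ (n κ : ℕ) (E : MatchgateEnsemble n) (ρ O : Op n),
      Even κ → 0 < κ → κ < 2 * n → IsPureGaussian ρ → IsModulePauli κ O →
        E.lossVariance ρ O = (n.choose (κ / 2) : ℝ) / ((2 * n).choose κ : ℝ)) ∧
    -- the variance strictly decreases with the globality
    (∀ (n κ κ' : ℕ) (E E' : MatchgateEnsemble n) (ρ ρ' O O' : Op n),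
      Even κ → 0 < κ → κ < 2 * n → IsPureGaussian ρ → IsModulePauli κ O →
      Even κ' → 0 < κ' → κ' < 2 * n → IsPureGaussian ρ' → IsModulePauli κ' O' →
      globality n κ < globality n κ' →
        E'.lossVariance ρ' O' < E.lossVariance ρ O) ∧
    -- scaling of the variance along sequences of problems
    (∀ (κ : ℕ → ℕ) (E : ∀ n, MatchgateEnsemble n) (ρ O : ∀ n, Op n),
      (∀ᶠ n in atTop, Even (κ n) ∧ 0 < κ n ∧ κ n < 2 * n ∧
        IsPureGaussian (ρ n) ∧ IsModulePauli (κ n) (O n)) →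
      -- exponential concentration
      (HasBarrenPlateau (fun n => (E n).lossVariance (ρ n) (O n)) ↔
        ∃ c : ℝ, 0 < c ∧ ∀ᶠ n : ℕ in atTop, c * (n : ℝ) ≤ (globality n (κ n) : ℝ)) ∧
      -- superpolynomial concentration
      (SuperpolynomialDecay atTop (fun n : ℕ => (n : ℝ))
          (fun n => (E n).lossVariance (ρ n) (O n)) ↔
        Tendsto (fun n => globality n (κ n)) atTop atTop) ∧
      (((fun n : ℕ => Real.log n) =o[atTop] fun n => (globality n (κ n) : ℝ)) →
        SuperpolynomialDecay atTop (fun n : ℕ => (n : ℝ))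
          (fun n => (E n).lossVariance (ρ n) (O n))) ∧
      -- inverse-polynomial lower bound
      ((∃ p : ℕ, (fun n : ℕ => 1 / (n : ℝ) ^ p) =O[atTop]
          fun n => (E n).lossVariance (ρ n) (O n)) ↔
        ∃ T : ℕ, ∀ᶠ n : ℕ in atTop, globality n (κ n) ≤ T) ∧
      -- globality independent of the number of qubits
      (∀ m : ℕ, (∀ᶠ n in atTop, globality n (κ n) = 2 * m) →
        ((fun n => (E n).lossVariance (ρ n) (O n)) =Θ[atTop] fun n : ℕ => 1 / (n : ℝ) ^ m) ∧
        ¬ HasBarrenPlateau (fun n => (E n).lossVariance (ρ n) (O n)))) := by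

  refine ⟨fun n κ E ρ O hκ hκ0 hκn hρ hO => E.lossVariance_eq_div hκ hκ0 hκn hρ hO, ?_, ?_⟩
  · intro n κ κ' E E' ρ ρ' O O' hκ hκ0 hκn hρ hO hκ' hκ0' hκn' hρ' hO' hg
    obtain ⟨h1, h2, h3⟩ := E.lossVariance_eq_chooseRatio hκ hκ0 hκn hρ hO
    obtain ⟨h1', h2', h3'⟩ := E'.lossVariance_eq_chooseRatio hκ' hκ0' hκn' hρ' hO'
    rw [h1, h1']
    exact chooseRatio_lt_of_lt (by omega) h3'
  · intro κ E ρ O h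
    set v : ℕ → ℝ := fun n => (E n).lossVariance (ρ n) (O n) with hvdef
    set m : ℕ → ℕ := fun n => globality n (κ n) / 2 with hmdef
    have hall : ∀ᶠ n in atTop, v n = chooseRatio n (m n) ∧ globality n (κ n) = 2 * m n ∧
        2 * m n ≤ n := by
      filter_upwards [h] with n ⟨hκ, hκ0, hκn, hρ, hO⟩
      exact (E n).lossVariance_eq_chooseRatio hκ hκ0 hκn hρ hO
    have hv : ∀ᶠ n in atTop, v n = chooseRatio n (m n) ∧ 2 * m n ≤ n :=
      hall.mono fun n hn => ⟨hn.1, hn.2.2⟩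
    have hg : ∀ᶠ n in atTop, globality n (κ n) = 2 * m n := hall.mono fun n hn => hn.2.1
    have htend : Tendsto m atTop atTop ↔ Tendsto (fun n => globality n (κ n)) atTop atTop := by
      rw [tendsto_congr' hg]
      simp only [tendsto_atTop]
      refine ⟨fun ht p => (ht p).mono fun n hn => by omega,
        fun ht p => (ht (2 * p)).mono fun n hn => by omega⟩
    have hsup := (superpolynomialDecay_iff hv).trans htend
    refine ⟨(hasBarrenPlateau_iff hv).trans ?_, hsup, fun hlog => hsup.mpr ?_,
      (one_div_pow_isBigO_iff hv).trans ?_, fun M hM => ?_⟩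
    · refine exists_congr fun c => and_congr_right fun _ => eventually_congr ?_
      filter_upwards [hg] with n hn
      rw [hn]
    -- Only `log n ≤ g_n` for large `n` is needed from the little-o: it already forces `g_n → ∞`.
    · rw [← tendsto_natCast_atTop_iff (R := ℝ)]
      refine tendsto_atTop_mono' _ ?_ (Real.tendsto_log_atTop.comp tendsto_natCast_atTop_atTop)
      filter_upwards [hlog.def one_pos] with n hn
      rw [one_mul, Real.norm_of_nonneg (Nat.cast_nonneg _)] at hn
      exact (le_abs_self _).trans hn
    · constructor
      · rintro ⟨T, hT⟩
        exact ⟨2 * T, by filter_upwards [hT, hg] with n hn hgn; omega⟩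
      · rintro ⟨T, hT⟩
        exact ⟨T, by filter_upwards [hT, hg] with n hn hgn; omega⟩
    · have hM' : ∀ᶠ n in atTop, m n = M := by
        filter_upwards [hM, hg] with n hn hgn
        omega
      exact ⟨isTheta_of_eventually_eq hv hM', not_hasBarrenPlateau_of_eventually_eq hv hM'⟩
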